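/- **Setting.** Fix an even $n\ge 6$. A *matrix of Mandelstam invariants* is a symmetric complex matrix $(s_{ab})_{1\le a,b\le n}$ with $s_{aa}=0$ and $\sum_{b}s_{ab}=0$ for every $a$. For a set $S$ of labels put $s_S=\sum_{a<b,\ a,b\in S}s_{ab}$. For $i<j<k$ the matrix lies on $(i,j,k)$ *split kinematics* if $s_{ab}=0$ whenever $a,b$ lie in two different open cyclic arcs cut out of $1,\dots,n$ by $i,j,k$. $A_n(s)$ denotes the tree-level partial amplitude $A_n^{\rm NLSM}(1,2,\dots,n)$ of the non-linear sigma model $\mathcal L=\frac1{8\lambda^2}{\rm Tr}(\partial_\mu U^\dagger\partial^\mu U)$, $U=(1+\lambda\Phi)(1-\lambda\Phi)^{-1}$, that is, the sum of its planar Feynman diagrams: each internal line with momentum $P$ contributes $1/P^2$, and each vertex with an even number $2m\ge4$ of legs of momenta $P_0,\dots,P_{2m-1}$ (in cyclic order) contributes $-(P_0+P_2+\dots+P_{2m-2})^2$ (so $A_4=s_{12}+s_{23}$). $\mathcal J(s)=\mathcal J^{{\rm NLSM}\oplus\phi^3}(5,\dots,n\,|\,1,I,4)$ denotes the amputated $(n-1)$-point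 current with legs $4,5,\dots,n,1,I$ in cyclic order, where $5,\dots,n$ are pions, $4,1$ and the off-shell leg $I$ are biadjoint scalars; in its planar Feynman diagrams two biadjoint scalars couple like two pions, and three biadjoint scalars meet in a vertex equal to $1$ if there is an even number of pion legs between any two cyclically neighbouring scalar legs, and $0$ otherwise. **Deformation.** Let $s_{ab}(z)=s_{ab}+z\,r_{ab}$, where $r$ is a matrix of Mandelstam invariants with $r_{2b}=-s_{2b}$ and $r_{3b}=s_{3b}$ for $b=5,\dots,n$, so that $s_{2b}(z)=(1-z)s_{2b}$ and $s_{3b}(z)=(1+z)s_{3b}$. Let $\mathcal P_n$ be the set of planar invariants $s_I$, $I$ a cyclic interval of odd size between $3$ and $n-3$, an interval and its complement (which have the same invariant) being counted once. Assume that for every $s_I\in\mathcal P_n$ the polynomial $s_I(z)$ has degree exactly one, with zero $z_I^*$; that $s_I(z)\neq0$ for $z\in\{0,1,-1\}$; and that $z_I^*\ne z_J^*$ for distinct compatible (non-crossing) poles. Write $A(z)=A_n(s(z))$. **Recursion.** Then $s(z)$ is a matrix of Mandelstam invariants for every $z$; $s(1)$ lies on $(1,3,4)$ and $s(-1)$ on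 $(1,2,4)$ split kinematics; $A_n(s)=\frac1{2\pi i}\oint_{|z|=\epsilon}\frac{A(z)}{z(1-z^2)}dz$ for all small $\epsilon>0$; there is no contribution from infinity, $A(z)/(1-z^2)\to0$ as $|z|\to\infty$; and $$A_n(s)=\tfrac12A(1)+\tfrac12A(-1)+\sum_{s_I\in\mathcal P_n}A_L(z_I^*)\,\frac1{(1-(z_I^*)^2)\,s_I}\,A_R(z_I^*),$$ where $A_L(z_I^*)$ and $A_R(z_I^*)$ are the lower-point NLSM amplitudes of the particles in $I$, respectively not in $I$, together with the internal on-shell particle, at the kinematics $s(z_I^*)$. Moreover $$A(1)=\mathcal J(s(1))\,\bigl(s_{12}(1)+s_{23}(1)\bigr),\qquad s_{12}(1)+s_{23}(1)=-(s_{24}+r_{24}),$$ $$A(-1)=\mathcal J(s(-1))\,\bigl(s_{23}(-1)+s_{34}(-1)\bigr),\qquad s_{23}(-1)+s_{34}(-1)=-(s_{13}-r_{13}).$$ **Six points.** For $n=6$ and every matrix of Mandelstam invariants with $s_{123},s_{234},s_{345}\ne0$, $$A_6=\frac{(s_{12}+s_{23}-s_{123})(s_{45}+s_{56})}{s_{123}}+\frac{(s_{23}+s_{34})(s_{56}+s_{61}-s_{234})}{s_{234}}+\frac{(s_{34}+s_{45}-s_{345})(s_{61}+s_{12}-s_{345})}{s_{345}}+s_{34}+s_{45}-s_{345},$$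 and, if $s_{456},s_{561}\ne 0$, the current $\mathcal J^{{\rm NLSM}\oplus\phi^3}(5,6\,|\,1,I,4)$ equals $\dfrac{s_{45}+s_{56}}{s_{456}}+\dfrac{s_{56}+s_{61}}{s_{561}}-1$. -/

import Mathlib

open Finset Filter Topology

noncomputable section

namespace NLSM

/-- `s` is a matrix of Mandelstam invariants `s a b = (p_a + p_b)^2` of `n` massless particles
labelled `1, …, n`: symmetric, zero diagonal, momentum conservation.  (Only the entries with labels
in `1, …, n` matter.) -/
structure IsMandelstam (n : ℕ) (s : ℕ → ℕ → ℂ) : Prop where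
  symm : ∀ a ∈ Icc 1 n, ∀ b ∈ Icc 1 n, s a b = s b a
  diag : ∀ a ∈ Icc 1 n, s a a = 0
  conservation : ∀ a ∈ Icc 1 n, ∑ b ∈ Icc 1 n, s a b = 0

/-- `s_S = (∑_{a ∈ S} p_a)^2`, the invariant of a set `S` of massless particles. -/
def inv (s : ℕ → ℕ → ℂ) (S : Finset ℕ) : ℂ :=
  ∑ a ∈ S, ∑ b ∈ S with a < b, s a b

/-- `(i, j, k)` split kinematics: `s a b = 0` whenever `a` and `b` lie in two different ones of the
three open cyclic arcs that `i < j < k` cut out of `1, …, n`. -/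
def IsSplit (n i j k : ℕ) (s : ℕ → ℕ → ℂ) : Prop :=
  ∀ a ∈ Icc 1 n, ∀ b ∈ Icc 1 n,
    ((i < a ∧ a < j) ∧ (j < b ∧ b < k) → s a b = 0) ∧
    ((j < a ∧ a < k) ∧ (k < b ∨ b < i) → s a b = 0) ∧
    ((k < a ∨ a < i) ∧ (i < b ∧ b < j) → s a b = 0)

/-! ### Planar Feynman rules

The tree-level partial amplitudes, for the canonical ordering, of the `U(N)` non-linear sigma model
`L = Tr(∂U† ∂U) / (8 λ^2)`, `U = (1 + λΦ)(1 - λΦ)⁻¹`, and of its extension NLSM ⊕ φ³ by biadjoint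
scalars, where at most three scalars appear.

* Propagator: `1 / P^2`.
* In terms of the (anti-Hermitian) field `Φ` the Lagrangian is
  `-(1/2) Tr[∂Φ (1 - λ²Φ²)⁻¹ ∂Φ (1 - λ²Φ²)⁻¹]`.  Its flavour-ordered vertex with legs of momenta
  `P_0, …, P_{2m-1}` is the sum of `P_a · P_b` over the pairs of opposite parity, which by momentum
  conservation is `-(P_0 + P_2 + … + P_{2m-2})^2`.  There is no vertex with an odd number of legs.
  (Normalisation: `λ = 1`, so that the four-point amplitude is `s_12 + s_23`.)
* A pair of biadjoint scalars with contracted second flavour index couples exactly as a pair of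
  pions does.
* Three biadjoint scalars meet in the vertex
  `Tr[φ^a (1 - λ²Φ²)⁻¹ φ^b (1 - λ²Φ²)⁻¹ φ^c (1 - λ²Φ²)⁻¹] f^{abc} / 3!`: the value is `1` if between
  any two cyclically neighbouring scalar legs there is an even number of pion legs, else `0`. -/

/-- The `l`-th block (`l = 0, 1, …`) of a composition of the interval `i, i+1, …, i+m-1`. -/
def block (i : ℕ) {m : ℕ} (c : Composition m) (l : ℕ) : Finset ℕ :=
  Ico (i + c.sizeUpTo l) (i + c.sizeUpTo (l + 1))

/-- Let `β` (at most three labels) be the set of external biadjoint scalars.  The line that carries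
the total momentum of the set `B` of external particles is a biadjoint scalar if `B` contains one or
two of them, and a pion if it contains none or all three. -/
def IsScalarLine (β B : Finset ℕ) : Prop :=
  (β ∩ B).card = 1 ∨ (β ∩ B).card = 2

open Classical in
/-- Positions of the scalar legs at the vertex whose legs are, in cyclic order, the lines of the
blocks of `c` (positions `0, …, c.length - 1`) and the line of the whole interval (position
`c.length`). -/
def scalarLegs (β : Finset ℕ) (i : ℕ) {m : ℕ} (c : Composition m) : Finset ℕ :=
  (range c.length).filter (fun l => IsScalarLine β (block i c l)) ∪
    if IsScalarLine β (Ico i (i + m)) then {c.length} else ∅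

open Classical in
/-- The value of that vertex; it has `c.length + 1` legs. -/
def vertex (s : ℕ → ℕ → ℂ) (β : Finset ℕ) (i : ℕ) {m : ℕ} (c : Composition m) : ℂ :=
  if (scalarLegs β i c).card = 0 ∨ (scalarLegs β i c).card = 2 then
    if Even (c.length + 1) then
      -inv s (((range c.length).filter Even).biUnion (block i c))
    else 0
  else if ∃ q₁ q₂ q₃ : ℕ, q₁ < q₂ ∧ q₂ < q₃ ∧ scalarLegs β i c = {q₁, q₂, q₃} ∧
      Even (q₂ - q₁ - 1) ∧ Even (q₃ - q₂ - 1) ∧ Even (q₁ + (c.length - q₃)) then 1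
  else 0

/-- Propagator of the line of `B`; external legs carry none. -/
def propagator (s : ℕ → ℕ → ℂ) (B : Finset ℕ) : ℂ :=
  if B.card = 1 then 1 else 1 / inv s B

theorem blocksFun_lt {m : ℕ} (c : Composition m) (h : 2 ≤ c.length) (l : Fin c.length) :
    c.blocksFun l < m := by
  have hm : 0 < m := lt_of_lt_of_le (by omega) c.length_le
  refine (Composition.ne_single_iff hm).1 ?_ l
  intro hc
  have := (Composition.eq_single_iff_length hm).1 hc
  omega

/-- Berends–Giele recursion for the sum of all planar tree Feynman diagrams with external on-shell
legs `i, i+1, …, i+m-1` (those in `β` biadjoint scalars, the others pions) and one further, amputated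
leg, which carries minus their total momentum and may be off-shell: the latter leg ends on a vertex
whose other legs are the lines of consecutive blocks. -/
def amputatedCurrent (s : ℕ → ℕ → ℂ) (β : Finset ℕ) (m i : ℕ) : ℂ :=
  if m = 1 then 1
  else ∑ c : Composition m,
    if _h : 2 ≤ c.length then
      vertex s β i c *
        ∏ l : Fin c.length,
          (amputatedCurrent s β (c.blocksFun l) (i + c.sizeUpTo l) * propagator s (block i c l))
    else 0
termination_by m
decreasing_by exact blocksFun_lt c _h l

/-- The partial amplitude `A_n^{NLSM}(1, 2, …, n)`. -/
def amplitude (n : ℕ) (s : ℕ → ℕ → ℂ) : ℂ :=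
  amputatedCurrent s ∅ (n - 1) 1

/-- The amputated `(n-1)`-point current `J^{NLSM ⊕ φ³}(5, …, n | 1, I, 4)`: the legs are, in cyclic
order, `4, 5, …, n, 1, I`; `4`, `1` and the off-shell leg `I` are biadjoint scalars and `5, …, n` are
pions. -/
def mixedCurrent (n : ℕ) (s : ℕ → ℕ → ℂ) : ℂ :=
  let w : ℕ → ℕ := fun t => if t + 3 ≤ n then t + 3 else 1
  amputatedCurrent (fun a b => s (w a) (w b)) {1, n - 2} (n - 2) 1

/-! ### Planar poles and factorization -/

/-- The planar poles with an odd number of particles on either side.  A planar invariant is that of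
exactly one cyclic interval not containing the label `n`; so they are indexed by the pairs `(i, j)`
that stand for the interval `i, i+1, …, j` with `1 ≤ i < j ≤ n - 1`, of odd length between `3` and
`n - 3`. -/
def planarPoles (n : ℕ) : Finset (ℕ × ℕ) :=
  (Icc 1 (n - 1) ×ˢ Icc 1 (n - 1)).filter
    (fun I => I.1 < I.2 ∧ Even (I.2 - I.1) ∧ I.2 - I.1 + 4 ≤ n)

/-- The planar invariant `s_{i, i+1, …, j}`. -/
def planarInv (s : ℕ → ℕ → ℂ) (I : ℕ × ℕ) : ℂ := inv s (Icc I.1 I.2)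

/-- Two planar poles that can occur in a common Feynman diagram. -/
def Compatible (I J : ℕ × ℕ) : Prop :=
  Icc I.1 I.2 ⊆ Icc J.1 J.2 ∨ Icc J.1 J.2 ⊆ Icc I.1 I.2 ∨ Disjoint (Icc I.1 I.2) (Icc J.1 J.2)

/-- Mandelstam invariants when the particles in `C t` are replaced by a single on-shell particle `t`
with their total momentum. -/
def mergeLegs (s : ℕ → ℕ → ℂ) (C : ℕ → Finset ℕ) (a b : ℕ) : ℂ :=
  if a = b then 0 else ∑ x ∈ C a, ∑ y ∈ C b, s x y

/-- `A_L`: the amplitude of the particles `i, …, j` and the internal particle `P`, in this order. -/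
def leftAmplitude (n : ℕ) (s : ℕ → ℕ → ℂ) (I : ℕ × ℕ) : ℂ :=
  amplitude (I.2 - I.1 + 2) (mergeLegs s fun t =>
    if t ≤ I.2 - I.1 + 1 then {I.1 + t - 1} else Icc 1 n \ Icc I.1 I.2)

/-- `A_R`: the amplitude of the particles `1, …, i-1`, the internal particle and `j+1, …, n`, in this
order. -/
def rightAmplitude (n : ℕ) (s : ℕ → ℕ → ℂ) (I : ℕ × ℕ) : ℂ :=
  amplitude (n - (I.2 - I.1)) (mergeLegs s fun t =>
    if t < I.1 then {t} else if t = I.1 then Icc I.1 I.2 else {t + (I.2 - I.1)})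

/-! ### The deformation -/

/-- `s_ab(z) = s_ab + z r_ab`. -/
def deform (s r : ℕ → ℕ → ℂ) (z : ℂ) (a b : ℕ) : ℂ := s a b + z * r a b

/-- The deformation with `s_2b(z) = (1 - z) s_2b` and `s_3b(z) = (1 + z) s_3b` for `b = 5, …, n`,
which respects momentum conservation and makes all invariants of odd planar poles polynomials in `z`
of degree exactly one; otherwise `r` is arbitrary. -/
structure IsSplitDeformation (n : ℕ) (s r : ℕ → ℕ → ℂ) : Prop where
  isMandelstam : IsMandelstam n r
  two : ∀ b ∈ Icc 5 n, r 2 b = -s 2 b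
  three : ∀ b ∈ Icc 5 n, r 3 b = s 3 b
  degree_one : ∀ I ∈ planarPoles n, planarInv r I ≠ 0

/-- The zero `z^*` of the planar invariant `s_I(z)`. -/
def zStar (s r : ℕ → ℕ → ℂ) (I : ℕ × ℕ) : ℂ := -planarInv s I / planarInv r I

end NLSM

end

/-! Two independent facts are combined.

The recursion is the residue theorem for $A(z)/(z(1-z^2))$, made purely algebraic: $A(z)$ is an
affine function of $z$ plus simple poles at the $z_I^*$. This is power counting along the
Berends–Giele recursion. A current with its propagator is a constant plus simple poles
(`DressedFactorizes`). A product over disjoint blocks keeps this form, because compatible poles lie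
at different points (`prodBlocks_factorizes`). The vertex is affine in $z$, so multiplying by it
gives an affine function plus poles (`current_factorizes`). Dividing by the invariant of degree one
gives back a constant plus poles (`dressed_factorizes`). The residue at $z_I^*$ comes from the
diagrams with a line carrying $P_I$. They are found by selecting the compositions with a block
containing $I$ and shrinking that block (`csum_contract`). Since $P_I^2=0$ there, the particles of
$I$ may be replaced by one massless leg without changing any invariant (`inv_pinched`), and the
residue is $A_LA_R$ over the slope of $s_I(z)$ (`amplitude_factorizes`). Evaluating the expansion at
$0,1,-1$ gives the formula (`IsAffinePartialFraction.value_zero`).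

The splitting at $z=\pm1$ rests on current conservation. The vertex joining the blocks of
$1,\dots,n-1$ to leg $n$ is $-(P_{\rm even})^2=-(P_{\rm odd}+p_n)^2$. The part $(P_{\rm odd})^2$
cancels in the sum by the equation of motion (`csum_odds_eq_zero`), leaving $2p_n\cdot P_{\rm odd}$
(`amplitude_eq_conserved`). On split kinematics only one leg can contribute to this product, which
forces an end block to have size one. What remains is a sum over even numbers of blocks with weight
one, and this is the current with three scalars (`mixedCurrent_eq_csum`). Cyclic invariance
(`current_cyclic`) brings leg 2 or 3 to position $n$. The six-point formulas follow by enumerating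
the compositions. -/

noncomputable section

namespace NLSM

/-! ### Sums over compositions -/

/-- Sum over the compositions of `m` of a function of the list of blocks. -/
def csum (m : ℕ) (f : List ℕ → ℂ) : ℂ := ∑ c : Composition m, f c.blocks

theorem csum_congr {m : ℕ} {f g : List ℕ → ℂ}
    (h : ∀ l : List ℕ, l.sum = m → (∀ x ∈ l, 0 < x) → f l = g l) : csum m f = csum m g :=
  Finset.sum_congr rfl fun c _ => h c.blocks c.blocks_sum fun _ hx => c.blocks_pos hx

theorem csum_zero (f : List ℕ → ℂ) : csum 0 f = f [] := by
  rw [csum_congr (g := fun _ => f []) fun l hl hpos => ?_]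
  · simp [csum, composition_card]
  · rcases l with _ | ⟨k, l⟩
    · rfl
    · have := hpos k (by simp)
      simp at hl
      omega

theorem csum_cons {m : ℕ} (hm : 0 < m) (f : List ℕ → ℂ) :
    csum m f = ∑ k ∈ Icc 1 m, csum (m - k) fun l => f (k :: l) := by
  unfold csum
  rw [Finset.sum_sigma' (Icc 1 m) (fun k => (univ : Finset (Composition (m - k))))
    (fun k c => f (k :: c.blocks))]
  symm
  refine Finset.sum_bij (fun x hx => (⟨x.1 :: x.2.blocks, ?_, ?_⟩ : Composition m)) ?_ ?_ ?_ ?_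
  · intro j hj
    have h1 := (Finset.mem_Icc.1 (Finset.mem_sigma.1 hx).1).1
    rcases List.mem_cons.1 hj with rfl | h
    · exact h1
    · exact x.2.blocks_pos h
  · have h1 := (Finset.mem_Icc.1 (Finset.mem_sigma.1 hx).1).2
    rw [List.sum_cons, x.2.blocks_sum]
    omega
  · intro a ha
    exact Finset.mem_univ _
  · rintro ⟨k, c⟩ _ ⟨k', c'⟩ _ h
    have h' := congrArg Composition.blocks h
    simp only [List.cons.injEq] at h'
    obtain ⟨rfl, h2⟩ := h'
    rw [Composition.ext h2]
  · intro c _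
    rcases hb : c.blocks with _ | ⟨k, l⟩
    · have := c.blocks_sum
      rw [hb] at this
      simp at this
      omega
    · have hs := c.blocks_sum
      rw [hb, List.sum_cons] at hs
      have hk : 0 < k := c.blocks_pos (by rw [hb]; simp)
      refine ⟨⟨k, ⟨l, fun {j} hj => c.blocks_pos (by rw [hb]; simp [hj]), by omega⟩⟩, ?_, ?_⟩
      · simp only [Finset.mem_sigma, Finset.mem_Icc, Finset.mem_univ, and_true]
        omega
      · apply Composition.ext
        exact hb.symm
  · intro a ha
    rfl

theorem csum_mul_left {m : ℕ} (a : ℂ) (f : List ℕ → ℂ) :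
    csum m (fun l => a * f l) = a * csum m f := (Finset.mul_sum _ _ _).symm

theorem csum_neg {m : ℕ} (f : List ℕ → ℂ) :
    csum m (fun l => - f l) = - csum m f := Finset.sum_neg_distrib _

theorem csum_add {m : ℕ} (f g : List ℕ → ℂ) :
    csum m (fun l => f l + g l) = csum m f + csum m g := Finset.sum_add_distrib

theorem csum_eq_zero {m : ℕ} {f : List ℕ → ℂ}
    (h : ∀ l : List ℕ, l.sum = m → (∀ x ∈ l, 0 < x) → f l = 0) : csum m f = 0 :=
  Finset.sum_eq_zero fun c _ => h c.blocks c.blocks_sum fun _ hx => c.blocks_pos hx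

/-- Reversing the list of blocks permutes the compositions, so the last block can be peeled off as
the first one is. -/
theorem csum_concat {m : ℕ} (hm : 0 < m) (f : List ℕ → ℂ) :
    csum m f = ∑ k ∈ Icc 1 m, csum (m - k) fun l => f (l ++ [k]) := by
  have key : ∀ (m : ℕ) (f : List ℕ → ℂ), csum m (fun l => f l.reverse) = csum m f := by
    intro m f
    refine Finset.sum_bij (fun c _ => (⟨c.blocks.reverse, ?_, ?_⟩ : Composition m)) ?_ ?_ ?_ ?_
    · intro j hj
      exact c.blocks_pos (List.mem_reverse.1 hj)
    · rw [List.sum_reverse, c.blocks_sum]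
    · simp
    · intro a _ b _ h
      exact Composition.ext (List.reverse_injective (congrArg Composition.blocks h))
    · intro c _
      exact ⟨⟨c.blocks.reverse, fun hj => c.blocks_pos (List.mem_reverse.1 hj),
        by rw [List.sum_reverse, c.blocks_sum]⟩, Finset.mem_univ _,
        Composition.ext (List.reverse_reverse _)⟩
    · intros
      rfl
  rw [← key m f, csum_cons hm]
  refine Finset.sum_congr rfl fun k _ => ?_
  rw [← key (m - k) (fun l => f (l ++ [k]))]
  simp

/-! ### Functions of the list of blocks of an interval -/

/-- The product of `g` over the blocks with sizes `l` of an interval starting at `i`. -/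
def prodBlocks (g : ℕ → ℕ → ℂ) : ℕ → List ℕ → ℂ
  | _, [] => 1
  | i, k :: l => g k i * prodBlocks g (i + k) l

/-- `true`: the union of the blocks at even positions; `false`: at odd positions. -/
def alternating : Bool → ℕ → List ℕ → Finset ℕ
  | _, _, [] => ∅
  | true, i, k :: l => Ico i (i + k) ∪ alternating false (i + k) l
  | false, i, k :: l => alternating true (i + k) l

/-- The union of the blocks at even positions. -/
abbrev evens := alternating true

/-- The union of the blocks at odd positions. -/
abbrev odds := alternating false

theorem prodBlocks_append (g : ℕ → ℕ → ℂ) (i : ℕ) (l l' : List ℕ) :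
    prodBlocks g i (l ++ l') = prodBlocks g i l * prodBlocks g (i + l.sum) l' := by
  induction l generalizing i with
  | nil => simp [prodBlocks]
  | cons k l ih => simp [prodBlocks, ih, mul_assoc, add_assoc]

theorem prodBlocks_congr {g h : ℕ → ℕ → ℂ} {i : ℕ} {l : List ℕ} {d : ℕ}
    (H : ∀ k ∈ l, ∀ j, i ≤ j → j + k ≤ i + l.sum → g k (j + d) = h k j) :
    prodBlocks g (i + d) l = prodBlocks h i l := by
  induction l generalizing i with
  | nil => rfl
  | cons k l ih =>
    simp only [prodBlocks, List.sum_cons] at *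
    rw [H k (by simp) i le_rfl (by omega), ← ih (i := i + k)]
    · congr 2; omega
    · intro k' hk' j hj hj'
      exact H k' (by simp [hk']) j (by omega) (by omega)

theorem prodBlocks_eq_zero {g : ℕ → ℕ → ℂ} {l : List ℕ} (h : ∃ k ∈ l, ∀ j, g k j = 0) (i : ℕ) :
    prodBlocks g i l = 0 := by
  induction l generalizing i with
  | nil => simp at h
  | cons k l ih =>
    obtain ⟨k', hk', h0⟩ := h
    rcases List.mem_cons.1 hk' with rfl | h1
    · simp [prodBlocks, h0]
    · simp [prodBlocks, ih ⟨k', h1, h0⟩]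

theorem prodBlocks_eq_fin (g : ℕ → ℕ → ℂ) (i : ℕ) (l : List ℕ) :
    prodBlocks g i l = ∏ j : Fin l.length, g l[j] (i + (l.take j).sum) := by
  induction l generalizing i with
  | nil => simp [prodBlocks]
  | cons k l ih =>
    simp only [prodBlocks, ih, List.length_cons, Fin.prod_univ_succ]
    simp [add_assoc]

/-- Links the recursive form, convenient for peeling blocks, with the `biUnion` used in `vertex`. -/
theorem alternating_eq (b : Bool) (i : ℕ) (l : List ℕ) :
    alternating b i l = ((range l.length).filter (fun j => Even j ↔ b = true)).biUnion
      (fun j => Ico (i + (l.take j).sum) (i + (l.take (j + 1)).sum)) := by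
  induction l generalizing b i with
  | nil => simp [alternating]
  | cons k l ih =>
    ext x
    have split : ∀ P : ℕ → Prop, (∃ a, P a) ↔ P 0 ∨ ∃ a, P (a + 1) := by
      intro P
      constructor
      · rintro ⟨_ | a, h⟩
        · exact Or.inl h
        · exact Or.inr ⟨a, h⟩
      · rintro (h | ⟨a, h⟩)
        · exact ⟨0, h⟩
        · exact ⟨a + 1, h⟩
    cases b <;>
    · simp only [alternating, ih, Finset.mem_biUnion, Finset.mem_filter, Finset.mem_range,
        Finset.mem_union]
      conv_rhs => rw [split]
      simp [add_assoc, Nat.even_add_one]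

theorem alternating_append_singleton (b : Bool) (i : ℕ) (l : List ℕ) (k : ℕ) :
    alternating b i (l ++ [k]) = alternating b i l ∪
      if (Even l.length ↔ b = true) then Ico (i + l.sum) (i + l.sum + k) else ∅ := by
  induction l generalizing b i with
  | nil => cases b <;> simp [alternating]
  | cons k' l ih =>
    cases b <;> simp [alternating, ih, Nat.even_add_one, add_assoc]

theorem alternating_subset (b : Bool) (i : ℕ) (l : List ℕ) :
    alternating b i l ⊆ Ico i (i + l.sum) := by
  induction l generalizing b i with
  | nil => simp [alternating]
  | cons k l ih =>
    intro x hx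
    cases b
    · have := ih true (i + k) hx
      simp at this ⊢; omega
    · rcases Finset.mem_union.1 hx with h | h
      · simp at h ⊢; omega
      · have := ih false (i + k) h
        simp at this ⊢; omega

theorem alternating_union (i : ℕ) (l : List ℕ) :
    evens i l ∪ odds i l = Ico i (i + l.sum) := by
  induction l generalizing i with
  | nil => simp [alternating]
  | cons k l ih =>
    have := ih (i + k)
    ext x
    have h := Finset.ext_iff.1 this x
    simp [alternating] at h ⊢
    grind

theorem alternating_disjoint (i : ℕ) (l : List ℕ) : Disjoint (evens i l) (odds i l) := by
  induction l generalizing i with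
  | nil => simp [alternating]
  | cons k l ih =>
    simp only [evens, odds, alternating, Finset.disjoint_union_left]
    refine ⟨?_, (ih (i + k)).symm⟩
    refine Finset.disjoint_left.2 fun x hx hx' => ?_
    have := alternating_subset _ _ _ hx'
    simp at this hx
    omega

/-! ### The Berends–Giele recursion of the pion currents -/

/-- The current of the interval `i, …, i + m - 1` with its propagator. -/
def dressed (s : ℕ → ℕ → ℂ) (β : Finset ℕ) (m i : ℕ) : ℂ :=
  amputatedCurrent s β m i * propagator s (Ico i (i + m))

theorem amputatedCurrent_one (s : ℕ → ℕ → ℂ) (β : Finset ℕ) (i : ℕ) :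
    amputatedCurrent s β 1 i = 1 := by
  rw [amputatedCurrent]; simp

theorem dressed_one (s : ℕ → ℕ → ℂ) (β : Finset ℕ) (i : ℕ) : dressed s β 1 i = 1 := by
  simp [dressed, amputatedCurrent_one, propagator]

theorem prod_blocks_eq (g : ℕ → ℕ → ℂ) (i : ℕ) {m : ℕ} (c : Composition m) :
    ∏ l : Fin c.length, g (c.blocksFun l) (i + c.sizeUpTo l) = prodBlocks g i c.blocks := by
  rw [prodBlocks_eq_fin]
  rfl

theorem block_eq (i : ℕ) {m : ℕ} (c : Composition m) (l : Fin c.length) :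
    block i c l = Ico (i + c.sizeUpTo l) (i + c.sizeUpTo l + c.blocksFun l) := by
  unfold block
  rw [c.sizeUpTo_succ l.2, add_assoc]
  rfl

theorem amputatedCurrent_eq_sum (s : ℕ → ℕ → ℂ) (β : Finset ℕ) {m : ℕ} (hm : m ≠ 1) (i : ℕ) :
    amputatedCurrent s β m i = ∑ c : Composition m,
      if 2 ≤ c.length then vertex s β i c * prodBlocks (dressed s β) i c.blocks else 0 := by
  rw [amputatedCurrent, if_neg hm]
  refine Finset.sum_congr rfl fun c _ => ?_
  split_ifs with h
  · rw [← prod_blocks_eq]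
    congr 1
    refine Finset.prod_congr rfl fun l _ => ?_
    rw [dressed, block_eq]
  · rfl

theorem pion_vertex (s : ℕ → ℕ → ℂ) (i : ℕ) {m : ℕ} (c : Composition m)
    {β : Finset ℕ} (h : (scalarLegs β i c).card = 0 ∨ (scalarLegs β i c).card = 2) :
    vertex s β i c = if Odd c.blocks.length then -inv s (evens i c.blocks) else 0 := by
  unfold vertex
  rw [if_pos h]
  have : Even (c.length + 1) ↔ Odd c.blocks.length := by
    rw [Nat.even_add_one, Nat.not_even_iff_odd]
  simp only [this]
  rw [evens, alternating_eq]
  simp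
  rfl

theorem scalarLegs_empty (i : ℕ) {m : ℕ} (c : Composition m) : scalarLegs ∅ i c = ∅ := by
  simp [scalarLegs, IsScalarLine]

theorem current_eq_csum (s : ℕ → ℕ → ℂ) {m : ℕ} (hm : m ≠ 1) (i : ℕ) :
    amputatedCurrent s ∅ m i = csum m fun l =>
      if 2 ≤ l.length ∧ Odd l.length then -inv s (evens i l) * prodBlocks (dressed s ∅) i l
      else 0 := by
  rw [amputatedCurrent_eq_sum s ∅ hm, csum]
  refine Finset.sum_congr rfl fun c _ => ?_
  rw [pion_vertex s i c (by simp [scalarLegs_empty])]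
  rw [show c.length = c.blocks.length from rfl]
  split_ifs <;> simp_all

theorem exists_even_of_odd_length {l : List ℕ} (hl : Odd l.length) (hs : Even l.sum) :
    ∃ k ∈ l, Even k := by
  by_contra! h
  have : Odd l.length ↔ Odd l.sum := by
    clear hl hs
    induction l with
    | nil => simp
    | cons k l ih =>
      have h1 := h k (by simp)
      have h2 := ih fun x hx => h x (by simp [hx])
      simp only [List.length_cons, List.sum_cons]
      grind
  grind

theorem lt_sum_of_mem {l : List ℕ} (hpos : ∀ x ∈ l, 0 < x) (h2 : 2 ≤ l.length) {k : ℕ}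
    (h : k ∈ l) : k < l.sum := by
  obtain ⟨a, b, rfl⟩ := List.append_of_mem h
  simp only [List.sum_append, List.sum_cons]
  rcases a with _ | ⟨x, a⟩
  · rcases b with _ | ⟨y, b⟩
    · simp at h2
    · have := hpos y (by simp)
      simp; omega
  · have := hpos x (by simp)
    simp; omega

/-- Every vertex joins an odd number of blocks to the outgoing line, and an odd number of odd sizes
has an odd sum. So one block is even, and its current vanishes by induction. -/
theorem current_even (s : ℕ → ℕ → ℂ) {m : ℕ} (hm : Even m) (i : ℕ) :
    amputatedCurrent s ∅ m i = 0 := by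
  induction m using Nat.strong_induction_on generalizing i with
  | _ m ih =>
    rw [current_eq_csum s (by rintro rfl; simp at hm)]
    refine csum_eq_zero fun l hl hpos => ?_
    split_ifs with h
    · obtain ⟨k, hk, hk'⟩ := exists_even_of_odd_length h.2 (hl ▸ hm)
      rw [prodBlocks_eq_zero ⟨k, hk, fun j => ?_⟩, mul_zero]
      rw [dressed, ih k (hl ▸ lt_sum_of_mem hpos h.1 hk) hk', zero_mul]
    · rfl

theorem dressed_even (s : ℕ → ℕ → ℂ) {m : ℕ} (hm : Even m) (i : ℕ) : dressed s ∅ m i = 0 := by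
  rw [dressed, current_even s hm, zero_mul]

theorem inv_singleton (s : ℕ → ℕ → ℂ) (a : ℕ) : inv s {a} = 0 := by
  simp [inv, Finset.sum_filter]

theorem inv_congr {s s' : ℕ → ℕ → ℂ} {d : ℕ} {S : Finset ℕ}
    (h : ∀ a ∈ S, ∀ b ∈ S, s (a + d) (b + d) = s' a b) :
    inv s (S.map (addRightEmbedding d)) = inv s' S := by
  unfold inv
  rw [Finset.sum_map]
  refine Finset.sum_congr rfl fun a ha => ?_
  rw [Finset.filter_map, Finset.sum_map]
  simp only [Function.comp_def, addRightEmbedding_apply, add_lt_add_iff_right]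
  exact Finset.sum_congr rfl fun b hb => h a ha b (Finset.mem_filter.1 hb).1

theorem alternating_map (b : Bool) (i d : ℕ) (l : List ℕ) :
    (alternating b i l).map (addRightEmbedding d) = alternating b (i + d) l := by
  induction l generalizing b i with
  | nil => simp [alternating]
  | cons k l ih =>
    have : i + k + d = i + d + k := by omega
    cases b <;> simp [alternating, ih, Finset.map_union, this]

/-- Currents depend only on the invariants of their own legs and may be relabelled. -/
theorem current_shift {s s' : ℕ → ℕ → ℂ} {d m i : ℕ}
    (h : ∀ a ∈ Ico i (i + m), ∀ b ∈ Ico i (i + m), s (a + d) (b + d) = s' a b) :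
    amputatedCurrent s ∅ m (i + d) = amputatedCurrent s' ∅ m i := by
  induction m using Nat.strong_induction_on generalizing i with
  | _ m ih =>
    by_cases hm : m = 1
    · subst hm; rw [amputatedCurrent_one, amputatedCurrent_one]
    rw [current_eq_csum s hm, current_eq_csum s' hm]
    refine csum_congr fun l hl hpos => ?_
    split_ifs with h2
    · congr 1
      · rw [evens, ← alternating_map, inv_congr]
        intro a ha b hb
        have ha' := alternating_subset _ _ _ ha
        have hb' := alternating_subset _ _ _ hb
        rw [hl] at ha' hb'
        exact h a ha' b hb'
      · refine prodBlocks_congr fun k hk j hj hj' => ?_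
        have hsub : ∀ a ∈ Ico j (j + k), a ∈ Ico i (i + m) := by
          intro a ha
          simp at ha ⊢; omega
        have hloc : ∀ a ∈ Ico j (j + k), ∀ b ∈ Ico j (j + k), s (a + d) (b + d) = s' a b :=
          fun a ha b hb => h a (hsub a ha) b (hsub b hb)
        rw [dressed, dressed, ih k (hl ▸ lt_sum_of_mem hpos h2.1 hk) hloc]
        congr 1
        unfold propagator
        have : Ico (j + d) (j + d + k) = (Ico j (j + k)).map (addRightEmbedding d) := by
          rw [Finset.map_add_right_Ico]; congr 1; omega
        rw [this, Finset.card_map, inv_congr hloc]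
    · rfl

theorem dressed_shift {s s' : ℕ → ℕ → ℂ} {d m i : ℕ}
    (h : ∀ a ∈ Ico i (i + m), ∀ b ∈ Ico i (i + m), s (a + d) (b + d) = s' a b) :
    dressed s ∅ m (i + d) = dressed s' ∅ m i := by
  rw [dressed, dressed, current_shift h]
  congr 1
  unfold propagator
  have : Ico (i + d) (i + d + m) = (Ico i (i + m)).map (addRightEmbedding d) := by
    rw [Finset.map_add_right_Ico]; congr 1; omega
  rw [this, Finset.card_map, inv_congr h]

/-- Equation of motion of an off-shell current. -/
theorem csum_evens_eq_zero (s : ℕ → ℕ → ℂ) {m i : ℕ}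
    (h : Odd m → m ≠ 1 → inv s (Ico i (i + m)) ≠ 0) :
    csum m (fun l => if Odd l.length then inv s (evens i l) * prodBlocks (dressed s ∅) i l
      else 0) = 0 := by
  rcases Nat.even_or_odd m with hm | hm
  · refine csum_eq_zero fun l hl _ => ?_
    split_ifs with h2
    · obtain ⟨k, hk, hk'⟩ := exists_even_of_odd_length h2 (hl ▸ hm)
      rw [prodBlocks_eq_zero ⟨k, hk, fun j => dressed_even s hk' j⟩, mul_zero]
    · rfl
  by_cases h1 : m = 1
  · subst h1
    refine csum_eq_zero fun l hl hpos => ?_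
    split_ifs with h2
    · have : inv s (evens i l) = 0 := by
        have hsub := alternating_subset true i l
        rw [hl] at hsub
        rcases Finset.subset_singleton_iff.1 (by simpa using hsub) with h0 | h0
        · rw [evens, h0]; simp [inv]
        · rw [evens, h0, inv_singleton]
      rw [this, zero_mul]
    · rfl
  have hne := h hm h1
  have hm0 : 0 < m := hm.pos
  have hJ := current_eq_csum s h1 i
  -- Nonvanishing of the invariant is essential: with the convention `1 / 0 = 0` the left side would
  -- be zero.
  have hd : dressed s ∅ m i * inv s (Ico i (i + m)) = amputatedCurrent s ∅ m i := by
    unfold dressed propagator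
    rw [if_neg (by simpa using h1)]
    field_simp
  -- The one-block composition gives the amputated current, and all longer ones together give its
  -- negative, by the recursion.
  have hsplit : csum m (fun l => if Odd l.length then
        inv s (evens i l) * prodBlocks (dressed s ∅) i l else 0) =
      csum m (fun l => if l = [m] then inv s (Ico i (i + m)) * dressed s ∅ m i else 0) -
        amputatedCurrent s ∅ m i := by
    rw [hJ, sub_eq_add_neg, ← csum_neg, ← csum_add]
    refine csum_congr fun l hl hpos => ?_
    rcases l with _ | ⟨k, _ | ⟨k', l⟩⟩
    · simp
    · have : k = m := by simpa using hl
      subst this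
      simp [alternating, prodBlocks]
    · by_cases ho : Odd (k :: k' :: l).length
      · rw [if_pos ho, if_neg (by simp), if_pos ⟨by simp, ho⟩]; ring
      · rw [if_neg ho, if_neg (by simp), if_neg (fun h => ho h.2)]; ring
  rw [hsplit]
  have : csum m (fun l => if l = [m] then inv s (Ico i (i + m)) * dressed s ∅ m i else 0) =
      inv s (Ico i (i + m)) * dressed s ∅ m i := by
    unfold csum
    rw [Finset.sum_eq_single (Composition.single m hm0)]
    · simp [Composition.single]
    · intro c _ hc
      refine if_neg fun h => ?_
      exact hc (Composition.ext (by rw [h]; rfl))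
    · simp
  rw [this, ← hd]
  ring

/-! ### Mandelstam invariants -/

/-- The sum over ordered pairs does not refer to the order of the labels, so it can be split along
unions and regrouped into merged legs. -/
theorem two_mul_inv {s : ℕ → ℕ → ℂ} {S : Finset ℕ} (hs : ∀ a ∈ S, ∀ b ∈ S, s a b = s b a)
    (hd : ∀ a ∈ S, s a a = 0) : 2 * inv s S = ∑ a ∈ S, ∑ b ∈ S, s a b := by
  have h1 : inv s S = ∑ a ∈ S, ∑ b ∈ S, if a < b then s a b else 0 := by
    simp [inv, Finset.sum_filter]
  have h2 : inv s S = ∑ a ∈ S, ∑ b ∈ S, if b < a then s a b else 0 := by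
    rw [h1, Finset.sum_comm]
    refine Finset.sum_congr rfl fun a ha => Finset.sum_congr rfl fun b hb => ?_
    rw [hs a ha b hb]
  rw [two_mul]
  nth_rw 1 [h1]
  rw [h2, ← Finset.sum_add_distrib]
  refine Finset.sum_congr rfl fun a ha => ?_
  rw [← Finset.sum_add_distrib]
  refine Finset.sum_congr rfl fun b hb => ?_
  rcases lt_trichotomy a b with h | rfl | h
  · simp [h, h.not_gt]
  · simp [hd a ha]
  · simp [h, h.not_gt]

theorem IsMandelstam.two_mul_inv {n : ℕ} {s : ℕ → ℕ → ℂ} (hs : IsMandelstam n s) {S : Finset ℕ}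
    (hS : S ⊆ Icc 1 n) : 2 * inv s S = ∑ a ∈ S, ∑ b ∈ S, s a b :=
  NLSM.two_mul_inv (fun a ha b hb => hs.symm a (hS ha) b (hS hb)) fun a ha => hs.diag a (hS ha)

theorem IsMandelstam.inv_union {n : ℕ} {s : ℕ → ℕ → ℂ} (hs : IsMandelstam n s) {S T : Finset ℕ}
    (hS : S ⊆ Icc 1 n) (hT : T ⊆ Icc 1 n) (hST : Disjoint S T) :
    inv s (S ∪ T) = inv s S + inv s T + ∑ a ∈ S, ∑ b ∈ T, s a b := by
  have h := hs.two_mul_inv (Finset.union_subset hS hT)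
  have h1 := hs.two_mul_inv hS
  have h2 := hs.two_mul_inv hT
  have h3 : ∑ a ∈ T, ∑ b ∈ S, s a b = ∑ a ∈ S, ∑ b ∈ T, s a b := by
    rw [Finset.sum_comm]
    exact Finset.sum_congr rfl fun a ha => Finset.sum_congr rfl fun b hb =>
      hs.symm b (hT hb) a (hS ha)
  simp only [Finset.sum_union hST, Finset.sum_add_distrib] at h
  rw [h3, ← h1, ← h2] at h
  linear_combination h / 2

/-- $P_S=-P_T$: summing conservation over $S$ and over $T$ expresses both invariants by the same
cross term. -/
theorem IsMandelstam.inv_compl {n : ℕ} {s : ℕ → ℕ → ℂ} (hs : IsMandelstam n s) {S T : Finset ℕ}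
    (hST : Disjoint S T) (hU : S ∪ T = Icc 1 n) : inv s S = inv s T := by
  have hS : S ⊆ Icc 1 n := hU ▸ Finset.subset_union_left
  have hT : T ⊆ Icc 1 n := hU ▸ Finset.subset_union_right
  have h1 := hs.two_mul_inv hS
  have h2 := hs.two_mul_inv hT
  have h3 : ∑ a ∈ T, ∑ b ∈ S, s a b = ∑ a ∈ S, ∑ b ∈ T, s a b := by
    rw [Finset.sum_comm]
    exact Finset.sum_congr rfl fun a ha => Finset.sum_congr rfl fun b hb =>
      hs.symm b (hT hb) a (hS ha)
  have h4 : ∑ a ∈ S, (∑ b ∈ S, s a b + ∑ b ∈ T, s a b) = 0 :=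
    Finset.sum_eq_zero fun a ha => by
      rw [← Finset.sum_union hST, hU]; exact hs.conservation a (hS ha)
  have h5 : ∑ a ∈ T, (∑ b ∈ S, s a b + ∑ b ∈ T, s a b) = 0 :=
    Finset.sum_eq_zero fun a ha => by
      rw [← Finset.sum_union hST, hU]; exact hs.conservation a (hT ha)
  rw [Finset.sum_add_distrib] at h4 h5
  rw [h3] at h5
  linear_combination (h1 - h2 + h4 - h5) / 2

/-- No planar invariant of the poles of the `n`-point amplitude vanishes. -/
def Regular (n : ℕ) (s : ℕ → ℕ → ℂ) : Prop := ∀ I ∈ planarPoles n, planarInv s I ≠ 0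

theorem Regular.inv_ne_zero {n : ℕ} {s : ℕ → ℕ → ℂ} (h : Regular n s) {i m : ℕ} (hi : 1 ≤ i)
    (hm : Odd m) (hm1 : m ≠ 1) (hin : i + m ≤ n) (hmn : m + 3 ≤ n) :
    inv s (Ico i (i + m)) ≠ 0 := by
  have := h (i, i + m - 1) (by
    simp only [planarPoles, Finset.mem_filter, Finset.mem_product, Finset.mem_Icc]
    obtain ⟨k, rfl⟩ := hm
    refine ⟨⟨⟨?_, ?_⟩, ?_, ?_⟩, ?_, ⟨k, ?_⟩, ?_⟩ <;> omega)
  rw [planarInv] at this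
  convert this using 2
  ext x
  have := hm.pos
  simp; omega

/-! ### Kinematics under cyclic relabelling -/

/-- The cyclic relabelling `1 → 2 → … → n → 1`. -/
def rot (n t : ℕ) : ℕ := if t < n then t + 1 else 1

theorem rot_image {n : ℕ} (hn : 1 ≤ n) : (Icc 1 n).image (rot n) = Icc 1 n := by
  ext x
  simp only [Finset.mem_image, Finset.mem_Icc, rot]
  constructor
  · rintro ⟨a, ha, rfl⟩
    split_ifs <;> omega
  · intro hx
    by_cases h : x = 1
    · exact ⟨n, by omega, by simp [h]⟩
    · exact ⟨x - 1, by omega, by rw [if_pos (by omega)]; omega⟩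

theorem rot_injOn (n : ℕ) : Set.InjOn (rot n) (Icc 1 n : Finset ℕ) := by
  intro a ha b hb h
  simp only [Finset.coe_Icc, Set.mem_Icc, rot] at ha hb h
  split_ifs at h <;> omega

theorem rot_mem {n a : ℕ} (ha : a ∈ Icc 1 n) : rot n a ∈ Icc 1 n := by
  simp only [Finset.mem_Icc, rot] at *
  split_ifs <;> omega

theorem IsMandelstam.rot {n : ℕ} {s : ℕ → ℕ → ℂ} (hs : IsMandelstam n s) :
    IsMandelstam n fun a b => s (rot n a) (rot n b) where
  symm a ha b hb := hs.symm _ (rot_mem ha) _ (rot_mem hb)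
  diag a ha := hs.diag _ (rot_mem ha)
  conservation a ha := by
    rw [← Finset.sum_image (f := fun b => s (NLSM.rot n a) b) (rot_injOn n), rot_image]
    · exact hs.conservation _ (rot_mem ha)
    · simp at ha; omega

theorem inv_shift_one {n : ℕ} {s : ℕ → ℕ → ℂ} {S : Finset ℕ} (hS : S ⊆ Ico 1 n) :
    inv (fun a b => s (rot n a) (rot n b)) S = inv s (S.map (addRightEmbedding 1)) := by
  rw [inv_congr]
  intro a ha b hb
  have ha := Finset.mem_Ico.1 (hS ha)
  have hb := Finset.mem_Ico.1 (hS hb)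
  simp [rot, ha.2, hb.2]

theorem Regular.rot {n : ℕ} {s : ℕ → ℕ → ℂ} (hn : Even n) (hs : IsMandelstam n s)
    (h : Regular n s) : Regular n fun a b => s (rot n a) (rot n b) := by
  rintro ⟨i, j⟩ hI
  simp only [planarPoles, Finset.mem_filter, Finset.mem_product, Finset.mem_Icc] at hI
  obtain ⟨⟨hi, hj⟩, hij, he, h4⟩ := hI
  rw [planarInv, inv_shift_one (fun x hx => by simp at hx ⊢; omega), Finset.map_add_right_Icc]
  by_cases hjn : j + 1 ≤ n - 1
  · refine h (i + 1, j + 1) ?_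
    simp only [planarPoles, Finset.mem_filter, Finset.mem_product, Finset.mem_Icc]
    refine ⟨⟨⟨?_, ?_⟩, ?_, ?_⟩, ?_, ?_, ?_⟩ <;> try omega
    simpa using he
  -- The shifted interval contains the label `n`, so its complement `1, …, i` indexes the pole; its
  -- length is odd because `n` is even.
  · rw [hs.inv_compl (T := Icc 1 i) (Finset.disjoint_left.2 fun x hx hx' => by
      simp at hx hx'; omega) (by ext x; simp; omega)]
    refine h (1, i) ?_
    simp only [planarPoles, Finset.mem_filter, Finset.mem_product, Finset.mem_Icc]
    obtain ⟨a, ha⟩ := hn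
    obtain ⟨b, hb⟩ := he
    refine ⟨⟨⟨?_, ?_⟩, ?_, ?_⟩, ?_, ⟨a - b - 1, ?_⟩, ?_⟩ <;> omega

/-! ### Cyclic invariance of the amplitude -/

/-- The case `m = 1` is separate: a single leg has no vertex, so the sum is zero, whereas its
current is 1 by convention. -/
theorem csum_current (s : ℕ → ℕ → ℂ) (m i : ℕ) :
    (csum m fun l => if 2 ≤ l.length ∧ Odd l.length then
      -inv s (evens i l) * prodBlocks (dressed s ∅) i l else 0) =
    if m = 1 then 0 else amputatedCurrent s ∅ m i := by
  split_ifs with h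
  · subst h
    refine csum_eq_zero fun l hl hpos => ?_
    rcases l with _ | ⟨k, _ | ⟨k', l⟩⟩
    · simp
    · simp
    · have := hpos k (by simp)
      have := hpos k' (by simp)
      simp at hl; omega
  · exact (current_eq_csum s h i).symm

theorem sum_Icc_ends {f : ℕ → ℂ} {n : ℕ} (hn : 4 ≤ n) (h1 : f n = 0) (h2 : f (n - 1) = 0) :
    ∑ k ∈ Icc 1 n, f k = f 1 + ∑ k ∈ Icc 2 (n - 2), f k := by
  have : Icc 1 n = insert 1 (insert n (insert (n - 1) (Icc 2 (n - 2)))) := by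
    ext x; simp; omega
  rw [this, Finset.sum_insert (by simp; omega), Finset.sum_insert (by simp; omega),
    Finset.sum_insert (by simp; omega), h1, h2]
  ring

/-- Sum over the ways to join an even number of blocks of all `n` legs in one vertex, and peel off
either the last or the first block. A one-leg block gives the two sides of the claim. The other
terms are two currents joined by a propagator and agree under `k ↦ n - k`, because a channel and its
complement have the same invariant. -/
theorem current_cyclic {n : ℕ} {s : ℕ → ℕ → ℂ} (hn : 4 ≤ n) (hs : IsMandelstam n s) :
    amputatedCurrent s ∅ (n - 1) 1 = amputatedCurrent s ∅ (n - 1) 2 := by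
  set F : List ℕ → ℂ := fun l => if 4 ≤ l.length ∧ Even l.length then
    -inv s (evens 1 l) * prodBlocks (dressed s ∅) 1 l else 0 with hF
  have hX : ∀ m i, m ≠ 1 → (if m = 1 then 0 else amputatedCurrent s ∅ m i) =
    amputatedCurrent s ∅ m i := fun m i h => if_neg h
  have hlast : csum n F = ∑ k ∈ Icc 1 n, dressed s ∅ k (n - k + 1) *
      (if n - k = 1 then 0 else amputatedCurrent s ∅ (n - k) 1) := by
    rw [csum_concat (by omega)]
    refine Finset.sum_congr rfl fun k hk => ?_
    rw [← csum_current, ← csum_mul_left]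
    refine csum_congr fun l hl hpos => ?_
    simp only [hF, List.length_append, List.length_singleton]
    by_cases h : 2 ≤ l.length ∧ Odd l.length
    · have : 4 ≤ l.length + 1 ∧ Even (l.length + 1) := by
        obtain ⟨h1, a, ha⟩ := h
        exact ⟨by omega, a + 1, by omega⟩
      rw [if_pos h, if_pos this, evens, alternating_append_singleton, prodBlocks_append, hl,
        if_neg (by simpa using h.2)]
      simp [prodBlocks, add_comm 1]
      ring
    · rw [if_neg h, if_neg, mul_zero]
      rintro ⟨h1, a, ha⟩
      exact h ⟨by omega, a - 1, by omega⟩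
  have hfirst : csum n F = ∑ k ∈ Icc 1 n, dressed s ∅ k 1 *
      (if n - k = 1 then 0 else amputatedCurrent s ∅ (n - k) (1 + k)) := by
    rw [csum_cons (by omega)]
    refine Finset.sum_congr rfl fun k hk => ?_
    rw [Finset.mem_Icc] at hk
    rw [← csum_current, ← csum_mul_left]
    refine csum_congr fun l hl hpos => ?_
    simp only [hF, List.length_cons]
    by_cases h : 2 ≤ l.length ∧ Odd l.length
    · have : 4 ≤ l.length + 1 ∧ Even (l.length + 1) := by
        obtain ⟨h1, a, ha⟩ := h
        exact ⟨by omega, a + 1, by omega⟩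
      rw [if_pos h, if_pos this, prodBlocks]
      -- Removing the first block flips parities: the even blocks of the rest are the odd blocks of
      -- the whole, and they carry the opposite momentum.
      have hc : inv s (evens 1 (k :: l)) = inv s (evens (1 + k) l) := by
        refine hs.inv_compl (alternating_disjoint 1 (k :: l)) ?_
        have := alternating_union 1 (k :: l)
        rw [evens, odds] at this
        change _ ∪ alternating false 1 (k :: l) = _
        rw [this, List.sum_cons, hl]
        ext x; simp; omega
      rw [hc]; ring
    · rw [if_neg h, if_neg, mul_zero]
      rintro ⟨h1, a, ha⟩
      exact h ⟨by omega, a - 1, by omega⟩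
  -- The term `k = n` leaves an empty, hence even, interval, and `k = n - 1` leaves one leg with no
  -- vertex; both vanish.
  rw [hlast, sum_Icc_ends hn (by simp [current_even]) (by simp [show n - (n - 1) = 1 by omega]),
    sum_Icc_ends hn (by simp [current_even]) (by simp [show n - (n - 1) = 1 by omega]),
    dressed_one, dressed_one, hX _ _ (by omega), hX _ _ (by omega), one_mul, one_mul] at hfirst
  have hmid : ∑ k ∈ Icc 2 (n - 2), dressed s ∅ k (n - k + 1) *
      (if n - k = 1 then 0 else amputatedCurrent s ∅ (n - k) 1) =
      ∑ k ∈ Icc 2 (n - 2), dressed s ∅ k 1 *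
      (if n - k = 1 then 0 else amputatedCurrent s ∅ (n - k) (1 + k)) := by
    refine Finset.sum_nbij' (fun k => n - k) (fun k => n - k) ?_ ?_ ?_ ?_ ?_
    · intro k hk; simp at hk ⊢; omega
    · intro k hk; simp at hk ⊢; omega
    · intro k hk; simp at hk ⊢; omega
    · intro k hk; simp at hk ⊢; omega
    · intro k hk
      rw [Finset.mem_Icc] at hk
      rw [if_neg (by omega), if_neg (by omega), show n - (n - k) = k by omega, dressed, dressed,
        show 1 + (n - k) = n - k + 1 by omega]
      have : propagator s (Ico (n - k + 1) (n - k + 1 + k)) =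
          propagator s (Ico 1 (n - k + 1)) := by
        unfold propagator
        rw [if_neg (by simp; omega), if_neg (by simp; omega), hs.inv_compl
          (S := Ico (n - k + 1) (n - k + 1 + k)) (T := Ico 1 (n - k + 1))
          (Finset.disjoint_left.2 fun x hx hx' => by simp at hx hx'; omega)
          (by ext x; simp; omega)]
      rw [this]
      ring
  rw [hmid] at hfirst
  exact add_right_cancel hfirst

theorem amplitude_rot {n : ℕ} {s : ℕ → ℕ → ℂ} (hn : 4 ≤ n) (hs : IsMandelstam n s) :
    amplitude n s = amplitude n fun a b => s (rot n a) (rot n b) := by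
  rw [amplitude, current_cyclic hn hs, amplitude]
  refine current_shift (d := 1) fun a ha b hb => ?_
  rw [Finset.mem_Ico] at ha hb
  simp [rot, show a < n by omega, show b < n by omega]

/-! ### The amplitude from the conserved current -/

/-- With the first and last blocks fixed, the odd blocks of the whole are the even blocks of the
interior, so the equation of motion of the interior interval makes the sum vanish. Only invariants
of interior intervals have to be nonzero. -/
theorem csum_odds_eq_zero {s : ℕ → ℕ → ℂ} {m i : ℕ} (hm : 0 < m)
    (h : ∀ j k, i < j → j + k < i + m → Odd k → k ≠ 1 → inv s (Ico j (j + k)) ≠ 0) :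
    csum m (fun l => if Odd l.length then inv s (odds i l) * prodBlocks (dressed s ∅) i l
      else 0) = 0 := by
  rw [csum_cons hm]
  refine Finset.sum_eq_zero fun k hk => ?_
  rw [Finset.mem_Icc] at hk
  by_cases hmk : m - k = 0
  · rw [hmk, csum_zero]
    simp [alternating, inv]
  rw [csum_concat (by omega)]
  refine Finset.sum_eq_zero fun k' hk' => ?_
  rw [Finset.mem_Icc] at hk'
  refine Eq.trans ?_ (mul_eq_zero_of_right (dressed s ∅ k i * dressed s ∅ k' (i + k + (m - k - k')))
    (csum_evens_eq_zero s (m := m - k - k') (i := i + k)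
      fun ho h1 => h _ _ (by omega) (by omega) ho h1))
  rw [← csum_mul_left]
  refine csum_congr fun l hl hpos => ?_
  simp only [List.length_cons, List.length_append]
  by_cases ho : Odd l.length
  · rw [if_pos ho, if_pos (by simpa [parity_simps] using ho), prodBlocks, prodBlocks_append,
      show odds i (k :: (l ++ [k'])) = evens (i + k) (l ++ [k']) from rfl, evens,
      alternating_append_singleton, if_neg (by simpa using ho), hl]
    simp [prodBlocks]
    ring
  · rw [if_neg ho, if_neg (by simpa [parity_simps] using ho), mul_zero]

/-- Contraction of the conserved current of the legs `1, …, n - 1` with the momentum of the leg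
`n`. -/
theorem amplitude_eq_conserved {n : ℕ} {s : ℕ → ℕ → ℂ} (hn : 4 ≤ n) (hs : IsMandelstam n s)
    (hreg : Regular n s) :
    amplitude n s = -csum (n - 1) fun l => if Odd l.length then
      (∑ a ∈ odds 1 l, s n a) * prodBlocks (dressed s ∅) 1 l else 0 := by
  have h0 := csum_odds_eq_zero (s := s) (m := n - 1) (i := 1) (by omega)
    fun j k hj hk ho h1 => hreg.inv_ne_zero (by omega) ho h1 (by omega) (by omega)
  refine Eq.trans ?_ ((congrArg (fun x => -csum (n - 1) _ - x) h0).trans (sub_zero _))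
  rw [amplitude, current_eq_csum s (by omega), ← csum_neg, sub_eq_add_neg, ← csum_neg, ← csum_add]
  refine csum_congr fun l hl hpos => ?_
  by_cases ho : Odd l.length
  · have hU := alternating_union 1 l
    have hD := alternating_disjoint 1 l
    rw [hl, show 1 + (n - 1) = n by omega] at hU
    have hO : odds 1 l ⊆ Icc 1 n := (Finset.subset_union_right.trans hU.le).trans
      fun x hx => by simp at hx ⊢; omega
    have hn' : n ∉ evens 1 l ∪ odds 1 l := by rw [hU]; simp
    rw [Finset.mem_union, not_or] at hn'
    -- Momentum conservation moves the vertex to the odd blocks and leg `n`; expanding it isolates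
    -- the square that `h0` removes.
    have h1 : inv s (evens 1 l) = inv s (odds 1 l ∪ {n}) := by
      refine hs.inv_compl ?_ ?_
      · rw [Finset.disjoint_union_right]
        exact ⟨hD, Finset.disjoint_singleton_right.2 hn'.1⟩
      · rw [← Finset.union_assoc, hU]
        ext x; simp; omega
    rw [hs.inv_union hO (by simp; omega) (Finset.disjoint_singleton_right.2 hn'.2),
      inv_singleton, add_zero] at h1
    simp only [Finset.sum_singleton] at h1
    have h2 : ∑ a ∈ odds 1 l, s a n = ∑ a ∈ odds 1 l, s n a :=
      Finset.sum_congr rfl fun a ha => hs.symm a (hO ha) n (by simp; omega)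
    rw [h2] at h1
    rw [if_pos ho, if_pos ho]
    by_cases h3 : 2 ≤ l.length
    · rw [if_pos ⟨h3, ho⟩, h1]; ring
    -- A single block has no odd positions, so the restriction to at least two blocks can be
    -- dropped.
    · rw [if_neg fun h => h3 h.1]
      have : l.length = 1 := by have := ho.pos; omega
      obtain ⟨k, rfl⟩ := List.length_eq_one_iff.1 this
      simp [alternating, inv]
  · rw [if_neg ho, if_neg ho, if_neg fun h => ho h.2]; ring

/-! ### Currents with biadjoint scalars -/

theorem block_subset (i : ℕ) {m : ℕ} (c : Composition m) (l : ℕ) :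
    block i c l ⊆ Ico i (i + m) := by
  intro x hx
  have := c.sizeUpTo_le (l + 1)
  simp [block] at hx ⊢; omega

theorem mem_block_unique {i m : ℕ} {c : Composition m} {x j j' : ℕ} (h : x ∈ block i c j)
    (h' : x ∈ block i c j') : j = j' := by
  simp only [block, Finset.mem_Ico] at h h'
  by_contra hne
  rcases Nat.lt_or_gt_of_ne hne with hlt | hlt
  · have := c.monotone_sizeUpTo (show j + 1 ≤ j' from hlt)
    omega
  · have := c.monotone_sizeUpTo (show j' + 1 ≤ j from hlt)
    omega

theorem exists_mem_block {i m : ℕ} (c : Composition m) {x : ℕ} (h : x ∈ Ico i (i + m)) :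
    ∃ j < c.length, x ∈ block i c j := by
  rw [Finset.mem_Ico] at h
  let y : Fin m := ⟨x - i, by omega⟩
  refine ⟨c.index y, (c.index y).2, ?_⟩
  have h1 := c.sizeUpTo_index_le y
  have h2 : (y : ℕ) < c.sizeUpTo (c.index y + 1) := c.lt_sizeUpTo_index_succ y
  simp only [block, Finset.mem_Ico]
  simp only [y] at h1 h2 ⊢
  omega

/-- A single scalar enters through exactly one block and leaves through the line of the whole
interval. -/
theorem card_scalarLegs {β : Finset ℕ} {i m : ℕ} (c : Composition m)
    (h : (β ∩ Ico i (i + m)).card ≤ 1) :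
    (scalarLegs β i c).card = 0 ∨ (scalarLegs β i c).card = 2 := by
  have hle : ∀ l, β ∩ block i c l ⊆ β ∩ Ico i (i + m) := fun l =>
    Finset.inter_subset_inter_left (block_subset i c l)
  rcases Nat.le_one_iff_eq_zero_or_eq_one.1 h with h0 | h1
  · left
    have hz : ∀ l, (β ∩ block i c l).card = 0 := fun l =>
      Nat.le_zero.1 (h0 ▸ Finset.card_le_card (hle l))
    simp [scalarLegs, IsScalarLine, hz, h0]
  · right
    obtain ⟨x, hx⟩ := Finset.card_eq_one.1 h1
    have hxm : x ∈ β ∩ Ico i (i + m) := by rw [hx]; simp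
    obtain ⟨hxβ, hxI⟩ := Finset.mem_inter.1 hxm
    obtain ⟨j, hj, hxj⟩ := exists_mem_block c hxI
    have hblock : ∀ l, IsScalarLine β (block i c l) ↔ l = j := by
      intro l
      have hsub : β ∩ block i c l ⊆ {x} := hx ▸ hle l
      constructor
      · intro hl
        rcases Finset.subset_singleton_iff.1 hsub with h0 | h0
        · simp [IsScalarLine, h0] at hl
        · have : x ∈ β ∩ block i c l := by rw [h0]; simp
          exact mem_block_unique (Finset.mem_inter.1 this).2 hxj
      · rintro rfl
        left
        rw [(Finset.subset_singleton_iff.1 hsub).resolve_left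
          (Finset.ne_empty_of_mem (Finset.mem_inter.2 ⟨hxβ, hxj⟩))]
        simp
    have : scalarLegs β i c = {j, c.length} := by
      ext y
      simp only [scalarLegs, hblock, if_pos (show IsScalarLine β (Ico i (i + m)) from Or.inl h1),
        Finset.mem_union, Finset.mem_filter, Finset.mem_range, Finset.mem_insert,
        Finset.mem_singleton]
      constructor
      · rintro (⟨-, h⟩ | h) <;> simp [h]
      · rintro (h | h)
        · left; exact ⟨h ▸ hj, h⟩
        · right; exact h
    rw [this, Finset.card_pair hj.ne]

/-- A current with at most one scalar among its on-shell legs equals that of the pions. -/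
theorem current_eq_pion {s : ℕ → ℕ → ℂ} {β : Finset ℕ} {m i : ℕ}
    (h : (β ∩ Ico i (i + m)).card ≤ 1) :
    amputatedCurrent s β m i = amputatedCurrent s ∅ m i := by
  induction m using Nat.strong_induction_on generalizing i with
  | _ m ih =>
    by_cases hm : m = 1
    · subst hm; rw [amputatedCurrent_one, amputatedCurrent_one]
    rw [amputatedCurrent_eq_sum s β hm, amputatedCurrent_eq_sum s ∅ hm]
    refine Finset.sum_congr rfl fun c _ => ?_
    split_ifs with h2
    · rw [pion_vertex s i c (card_scalarLegs c h),
        pion_vertex s i c (card_scalarLegs c (by simp))]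
      congr 1
      refine prodBlocks_congr (d := 0) fun k hk j hj hj' => ?_
      rw [c.blocks_sum] at hj'
      rw [add_zero, dressed, dressed, ih k]
      · exact c.blocks_sum ▸ lt_sum_of_mem (fun x hx => c.blocks_pos hx) h2 hk
      · refine le_trans (Finset.card_le_card (Finset.inter_subset_inter_left ?_)) h
        intro x hx
        simp at hx ⊢; omega
    · rfl

/-- With at least two blocks the end labels lie in different blocks, the first and the last;
together with the off-shell line they form the three-scalar vertex. -/
theorem scalarLegs_ends {m : ℕ} (hm : 2 ≤ m) (c : Composition m) (hc : 2 ≤ c.length) :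
    scalarLegs {1, m} 1 c = {0, c.length - 1, c.length} := by
  have hwhole : IsScalarLine {1, m} (Ico 1 (1 + m)) := by
    right
    rw [show ({1, m} : Finset ℕ) ∩ Ico 1 (1 + m) = {1, m} by ext x; simp; omega,
      Finset.card_pair (by omega)]
  have hsc : ∀ B : Finset ℕ, IsScalarLine {1, m} B ↔ 1 ∈ B ∨ m ∈ B := by
    intro B
    by_cases h1 : 1 ∈ B <;> by_cases h2 : m ∈ B <;>
      simp [IsScalarLine, Finset.insert_inter_of_mem, Finset.insert_inter_of_notMem,
        Finset.singleton_inter_of_mem, Finset.singleton_inter_of_notMem, h1, h2]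
  have h1 : ∀ l, 1 ∈ block 1 c l ↔ l = 0 := by
    have h0 : 1 ∈ block 1 c 0 := by
      have := c.sizeUpTo_strict_mono (i := 0) (by omega)
      simp [block] at this ⊢; omega
    exact fun l => ⟨fun h => mem_block_unique h h0, fun h => h ▸ h0⟩
  have h2 : ∀ l, m ∈ block 1 c l ↔ l = c.length - 1 := by
    have h0 : m ∈ block 1 c (c.length - 1) := by
      have := c.sizeUpTo_strict_mono (i := c.length - 1) (by omega)
      rw [show c.length - 1 + 1 = c.length by omega, c.sizeUpTo_length] at this
      simp only [block, show c.length - 1 + 1 = c.length by omega, c.sizeUpTo_length]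
      simp; omega
    exact fun l => ⟨fun h => mem_block_unique h h0, fun h => h ▸ h0⟩
  ext y
  rw [scalarLegs, if_pos hwhole]
  simp only [hsc, h1, h2, Finset.mem_union, Finset.mem_filter, Finset.mem_range, Finset.mem_insert,
    Finset.mem_singleton]
  omega

/-- The only gap that can contain pions lies between the first and last blocks and holds `c.length -
2` of them. -/
theorem scalar_vertex (s : ℕ → ℕ → ℂ) {m : ℕ} (hm : 2 ≤ m) (c : Composition m)
    (hc : 2 ≤ c.length) : vertex s {1, m} 1 c = if Even c.blocks.length then 1 else 0 := by
  have hcard : (scalarLegs {1, m} 1 c).card = 3 := by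
    rw [scalarLegs_ends hm c hc, Finset.card_eq_three]
    exact ⟨_, _, _, by omega, by omega, by omega, rfl⟩
  have key : (∃ q₁ q₂ q₃ : ℕ, q₁ < q₂ ∧ q₂ < q₃ ∧ scalarLegs {1, m} 1 c = {q₁, q₂, q₃} ∧
      Even (q₂ - q₁ - 1) ∧ Even (q₃ - q₂ - 1) ∧ Even (q₁ + (c.length - q₃))) ↔
      Even c.blocks.length := by
    rw [scalarLegs_ends hm c hc]
    change _ ↔ Even c.length
    constructor
    · rintro ⟨q₁, q₂, q₃, h12, h23, hq, he, -, -⟩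
      have a1 : 0 ∈ ({q₁, q₂, q₃} : Finset ℕ) := by rw [← hq]; simp
      have a2 : c.length - 1 ∈ ({q₁, q₂, q₃} : Finset ℕ) := by rw [← hq]; simp
      have a3 : c.length ∈ ({q₁, q₂, q₃} : Finset ℕ) := by rw [← hq]; simp
      simp at a1 a2 a3
      obtain ⟨b, hb⟩ := he
      exact ⟨b + 1, by omega⟩
    · rintro ⟨b, hb⟩
      exact ⟨0, c.length - 1, c.length, by omega, by omega, rfl, ⟨b - 1, by omega⟩,
        ⟨0, by omega⟩, ⟨0, by omega⟩⟩
  unfold vertex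
  rw [if_neg (by omega)]
  by_cases he : Even c.blocks.length
  · rw [if_pos (key.2 he), if_pos he]
  · rw [if_neg (mt key.1 he), if_neg he]

/-- The cyclic relabelling `1, 2, … → 4, 5, …, n, 1` of the mixed current. -/
def mixedLabel (n t : ℕ) : ℕ := if t + 3 ≤ n then t + 3 else 1

/-- All three scalars meet at the vertex of the off-shell leg. Every block there contains at most
one scalar, so its current is a pion current. -/
theorem mixedCurrent_eq_csum {n : ℕ} (hn : 4 ≤ n) (s : ℕ → ℕ → ℂ) :
    mixedCurrent n s = csum (n - 2) fun l => if 2 ≤ l.length ∧ Even l.length then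
      prodBlocks (dressed (fun a b => s (mixedLabel n a) (mixedLabel n b)) ∅) 1 l else 0 := by
  change amputatedCurrent (fun a b => s (mixedLabel n a) (mixedLabel n b)) _ _ _ = _
  rw [amputatedCurrent_eq_sum _ _ (by omega), csum]
  refine Finset.sum_congr rfl fun c _ => ?_
  by_cases hc : 2 ≤ c.length
  · rw [if_pos hc, scalar_vertex _ (by omega) c hc]
    change 2 ≤ c.blocks.length at hc
    by_cases he : Even c.blocks.length
    · rw [if_pos he, if_pos ⟨hc, he⟩, one_mul]
      refine prodBlocks_congr (d := 0) fun k hk j hj hj' => ?_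
      have hk' := lt_sum_of_mem (fun x hx => c.blocks_pos hx) hc hk
      rw [c.blocks_sum] at hj' hk'
      rw [add_zero, dressed, dressed, current_eq_pion]
      rw [Finset.card_le_one]
      intro a ha b hb
      simp at ha hb
      omega
    · rw [if_neg he, if_neg fun h => he h.2, zero_mul]
  · rw [if_neg hc, if_neg fun h => hc h.1]

/-! ### Split kinematics -/

theorem rot_of_lt {n t : ℕ} (h : t < n) : rot n t = t + 1 := if_pos h

theorem rot_self (n : ℕ) : rot n n = 1 := if_neg (lt_irrefl n)

/-- Decides whether an end leg can contribute to the contraction with $p_n$ on split kinematics. -/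
theorem last_mem_alternating (b : Bool) (i : ℕ) {l : List ℕ} (hl : 0 < l.length)
    (hpos : ∀ x ∈ l, 0 < x) :
    i + l.sum - 1 ∈ alternating b i l ↔ (Odd l.length ↔ b = true) := by
  obtain ⟨l', k, rfl⟩ := List.eq_nil_or_concat l |>.resolve_left (by rintro rfl; simp at hl)
  have hk := hpos k (by simp)
  rw [List.concat_eq_append, alternating_append_singleton, Finset.mem_union]
  have h1 : i + (l' ++ [k]).sum - 1 ∉ alternating b i l' := fun h => by
    have := alternating_subset _ _ _ h
    simp at this; omega
  rw [or_iff_right h1]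
  simp only [List.length_append, List.length_singleton, List.sum_append, List.sum_singleton]
  have : Odd (l'.length + 1) ↔ Even l'.length := by simp [parity_simps]
  rw [this]
  split_ifs with h
  · simp only [h, Finset.mem_Ico, iff_true]
    omega
  · simp [h]

theorem sum_eq_of_support {O : Finset ℕ} {f : ℕ → ℂ} {x : ℕ} (h : ∀ a ∈ O, a ≠ x → f a = 0) :
    ∑ a ∈ O, f a = if x ∈ O then f x else 0 := by
  rw [← Finset.sum_ite_eq' O x f]
  refine Finset.sum_congr rfl fun a ha => ?_
  split_ifs with hx
  · rfl
  · exact h a ha hx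

/-- If the momentum of the leg `n` is orthogonal to those of the legs `3, …, n - 2`, the
amplitude is a multiple of a current of the legs `2, …, n - 1`. -/
theorem amplitude_split_second {n : ℕ} {s : ℕ → ℕ → ℂ} (hn : 6 ≤ n) (hs : IsMandelstam n s)
    (hreg : Regular n s) (h0 : ∀ a ∈ Icc 3 (n - 2), s n a = 0) :
    amplitude n s = -s n 2 * csum (n - 2) fun l => if 2 ≤ l.length ∧ Even l.length then
      prodBlocks (dressed s ∅) 2 l else 0 := by
  -- Only legs 1, 2 and `n - 1` can contribute to the contraction with leg `n`. Legs 1 and `n - 1`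
  -- lie in the first and last blocks, both at even positions; leg 2 is at an odd position only if
  -- the first block is `{1}`.
  rw [amplitude_eq_conserved (by omega) hs hreg, csum_cons (by omega),
    Finset.sum_eq_single_of_mem 1 (by simp; omega), neg_mul, ← csum_mul_left]
  · congr 1
    refine csum_congr fun l hl hpos => ?_
    simp only [List.length_cons]
    have hl0 : l ≠ [] := by rintro rfl; simp at hl; omega
    have hlen : 0 < l.length := List.length_pos_iff.2 hl0
    by_cases he : Even l.length
    · have h2 : 2 ≤ l.length := by obtain ⟨b, hb⟩ := he; omega
      rw [if_pos (by simpa [parity_simps] using he), if_pos ⟨h2, he⟩, prodBlocks, dressed_one,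
        one_mul, show odds 1 (1 :: l) = evens 2 l from rfl, sum_eq_of_support (x := 2), if_pos]
      · obtain ⟨k, l', rfl⟩ := List.exists_cons_of_ne_nil hl0
        have := hpos k (by simp)
        simp [alternating]; omega
      · intro a ha ha2
        apply h0
        have h1 := alternating_subset _ _ _ ha
        rw [hl] at h1
        have h3 : a ≠ n - 1 := by
          rintro rfl
          have := last_mem_alternating true 2 hlen hpos
          rw [hl, show 2 + (n - 1 - 1) - 1 = n - 1 by omega] at this
          have := this.1 ha
          simp at this
          exact Nat.not_even_iff_odd.2 this he
        simp at h1 ⊢; omega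
    · rw [if_neg (by simpa [parity_simps] using he), if_neg fun h => he h.2, mul_zero]
  · intro k hk hk1
    rw [Finset.mem_Icc] at hk
    refine csum_eq_zero fun l hl hpos => ?_
    split_ifs with ho
    · rw [Finset.sum_eq_zero, zero_mul]
      intro a ha
      apply h0
      have h1 := alternating_subset true (1 + k) l ha
      rw [hl] at h1
      have h3 : a ≠ n - 1 := by
        rintro rfl
        have := last_mem_alternating false 1 (l := k :: l) (by simp) (by
          rintro x hx
          rcases List.mem_cons.1 hx with rfl | h
          · omega
          · exact hpos x h)
        rw [List.sum_cons, hl, show 1 + (k + (n - 1 - k)) - 1 = n - 1 by omega] at this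
        have := this.1 ha
        simp only [ho, Bool.false_eq_true, iff_false, not_true] at this
      simp at h1 ⊢; omega
    · rfl

/-- If the momentum of the leg `n` is orthogonal to those of the legs `2, …, n - 3`, the
amplitude is a multiple of a current of the legs `1, …, n - 2`. -/
theorem amplitude_split_first {n : ℕ} {s : ℕ → ℕ → ℂ} (hn : 6 ≤ n) (hs : IsMandelstam n s)
    (hreg : Regular n s) (h0 : ∀ a ∈ Icc 2 (n - 3), s n a = 0) :
    amplitude n s = -s n (n - 2) * csum (n - 2) fun l => if 2 ≤ l.length ∧ Even l.length then
      prodBlocks (dressed s ∅) 1 l else 0 := by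
  have hfirst : ∀ l : List ℕ, (∀ x ∈ l, 0 < x) → 1 ∉ odds 1 l := by
    intro l hpos h
    rcases l with _ | ⟨k, l⟩
    · simp [alternating] at h
    · have := hpos k (by simp)
      have h := alternating_subset true (1 + k) l h
      simp at h; omega
  -- Mirror argument: only leg `n - 2` can contribute, and it lies in an odd block only if the last
  -- block is `{n - 1}`.
  rw [amplitude_eq_conserved (by omega) hs hreg, csum_concat (by omega),
    Finset.sum_eq_single_of_mem 1 (by simp; omega), neg_mul, ← csum_mul_left]
  · congr 1
    refine csum_congr fun l hl hpos => ?_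
    simp only [List.length_append, List.length_singleton]
    have hl0 : l ≠ [] := by rintro rfl; simp at hl; omega
    have hlen : 0 < l.length := List.length_pos_iff.2 hl0
    by_cases he : Even l.length
    · have h2 : 2 ≤ l.length := by obtain ⟨b, hb⟩ := he; omega
      rw [if_pos (by simpa [parity_simps] using he), if_pos ⟨h2, he⟩, prodBlocks_append,
        odds, alternating_append_singleton, if_neg (by simpa using he),
        Finset.union_empty, sum_eq_of_support (x := n - 2), if_pos]
      · simp [prodBlocks, dressed_one]
      · have := last_mem_alternating false 1 hlen hpos
        rw [hl, show 1 + (n - 1 - 1) - 1 = n - 2 by omega] at this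
        exact this.2 (by simpa using he)
      · intro a ha ha2
        apply h0
        have h1 := alternating_subset _ _ _ ha
        rw [hl] at h1
        have h3 : a ≠ 1 := fun h => hfirst l hpos (h ▸ ha)
        simp at h1 ⊢; omega
    · rw [if_neg (by simpa [parity_simps] using he), if_neg fun h => he h.2, mul_zero]
  · intro k hk hk1
    rw [Finset.mem_Icc] at hk
    refine csum_eq_zero fun l hl hpos => ?_
    simp only [List.length_append, List.length_singleton]
    by_cases he : Even l.length
    · rw [if_pos (by simpa [parity_simps] using he), Finset.sum_eq_zero, zero_mul]
      rw [odds, alternating_append_singleton, if_neg (by simpa using he), Finset.union_empty]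
      intro a ha
      apply h0
      have h1 := alternating_subset _ _ _ ha
      rw [hl] at h1
      have h3 : a ≠ 1 := fun h => hfirst l hpos (h ▸ ha)
      simp at h1 ⊢; omega
    · rw [if_neg (by simpa [parity_simps] using he)]

/-- Two rotations put leg 2 at position `n`; the legs `2, …, n - 1` of the rotated kinematics are
then `4, …, n, 1`. -/
theorem amplitude_split_two {n : ℕ} {s : ℕ → ℕ → ℂ} (hn : 6 ≤ n) (he : Even n)
    (hs : IsMandelstam n s) (hreg : Regular n s) (h0 : ∀ b ∈ Icc 5 n, s 2 b = 0) :
    amplitude n s = -s 2 4 * mixedCurrent n s := by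
  rw [amplitude_rot (by omega) hs, amplitude_rot (by omega) hs.rot,
    amplitude_split_second hn hs.rot.rot ((hreg.rot he hs).rot he hs.rot),
    mixedCurrent_eq_csum (by omega)]
  · congr 1
    · simp [rot, show 2 < n by omega, show 3 < n by omega, show 1 < n by omega]
    · refine csum_congr fun l hl hpos => ?_
      congr 1
      refine prodBlocks_congr (i := 1) (d := 1) fun k hk j hj hj' => ?_
      refine dressed_shift fun a ha b hb => ?_
      have key : ∀ a ∈ Ico j (j + k), rot n (rot n (a + 1)) = mixedLabel n a := by
        intro a ha
        simp only [rot, mixedLabel]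
        simp at ha
        split_ifs <;> omega
      simp only [key a ha, key b hb]
  · intro a ha
    rw [Finset.mem_Icc] at ha
    rw [rot_self, rot_of_lt (show 1 < n by omega), rot_of_lt (show a < n by omega),
      rot_of_lt (show a + 1 < n by omega)]
    exact h0 _ (by simp; omega)

/-- Three rotations put leg 3 at position `n`; now the positions `1, …, n - 2` carry `4, …, n, 1`,
whence the mirror version of the splitting. -/
theorem amplitude_split_three {n : ℕ} {s : ℕ → ℕ → ℂ} (hn : 6 ≤ n) (he : Even n)
    (hs : IsMandelstam n s) (hreg : Regular n s) (h0 : ∀ b ∈ Icc 5 n, s 3 b = 0) :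
    amplitude n s = -s 3 1 * mixedCurrent n s := by
  rw [amplitude_rot (by omega) hs, amplitude_rot (by omega) hs.rot,
    amplitude_rot (by omega) hs.rot.rot,
    amplitude_split_first hn hs.rot.rot.rot
      (((hreg.rot he hs).rot he hs.rot).rot he hs.rot.rot), mixedCurrent_eq_csum (by omega)]
  · congr 1
    · simp [rot, show 2 < n by omega, show n - 2 < n by omega, show 1 < n by omega,
        show n - 2 + 1 < n by omega, show ¬ n - 2 + 1 + 1 < n by omega]
    · refine csum_congr fun l hl hpos => ?_
      congr 1
      refine prodBlocks_congr (i := 1) (d := 0) fun k hk j hj hj' => ?_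
      refine dressed_shift (d := 0) fun a ha b hb => ?_
      have key : ∀ a ∈ Ico j (j + k), rot n (rot n (rot n (a + 0))) = mixedLabel n a := by
        intro a ha
        simp only [rot, mixedLabel]
        simp at ha
        split_ifs <;> omega
      simp only [key a ha, key b hb]
  · intro a ha
    rw [Finset.mem_Icc] at ha
    rw [rot_self, rot_of_lt (show 1 < n by omega), rot_of_lt (show 1 + 1 < n by omega),
      rot_of_lt (show a < n by omega), rot_of_lt (show a + 1 < n by omega),
      rot_of_lt (show a + 1 + 1 < n by omega)]
    exact h0 _ (by simp; omega)

/-! ### Partial fractions -/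

/-- Away from the points `ζ x`, `x ∈ D`, the function `f` is a constant plus simple poles with
residues `ρ x`. -/
def IsPartialFraction {ι : Type*} (ζ : ι → ℂ) (D : Finset ι) (ρ : ι → ℂ) (f : ℂ → ℂ) : Prop :=
  ∃ a, ∀ z, (∀ x ∈ D, z ≠ ζ x) → f z = a + ∑ x ∈ D, ρ x / (z - ζ x)

/-- Away from the points `ζ x`, `x ∈ D`, the function `f` is an affine function plus simple poles
with residues `ρ x`. -/
def IsAffinePartialFraction {ι : Type*} (ζ : ι → ℂ) (D : Finset ι) (ρ : ι → ℂ) (f : ℂ → ℂ) :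
    Prop :=
  ∃ a b, ∀ z, (∀ x ∈ D, z ≠ ζ x) → f z = a + b * z + ∑ x ∈ D, ρ x / (z - ζ x)

section PartialFraction

variable {ι : Type*} {ζ : ι → ℂ} {D D' : Finset ι} {ρ σ : ι → ℂ} {f g : ℂ → ℂ}

theorem IsPartialFraction.congr (h : IsPartialFraction ζ D ρ f) (hρ : ∀ x ∈ D, ρ x = σ x) :
    IsPartialFraction ζ D σ f := by
  obtain ⟨a, ha⟩ := h
  exact ⟨a, fun z hz => by rw [ha z hz, Finset.sum_congr rfl fun x hx => by rw [hρ x hx]]⟩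

theorem IsAffinePartialFraction.congr (h : IsAffinePartialFraction ζ D ρ f)
    (hρ : ∀ x ∈ D, ρ x = σ x) : IsAffinePartialFraction ζ D σ f := by
  obtain ⟨a, b, ha⟩ := h
  exact ⟨a, b, fun z hz => by rw [ha z hz, Finset.sum_congr rfl fun x hx => by rw [hρ x hx]]⟩

theorem IsPartialFraction.extend [DecidableEq ι] (h : IsPartialFraction ζ D ρ f) (hD : D ⊆ D') :
    IsPartialFraction ζ D' (fun x => if x ∈ D then ρ x else 0) f := by
  obtain ⟨a, ha⟩ := h
  refine ⟨a, fun z hz => ?_⟩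
  beta_reduce
  rw [ha z fun x hx => hz x (hD hx), ← Finset.sum_subset hD]
  · congr 1
    exact Finset.sum_congr rfl fun x hx => by simp only [if_pos hx]
  · intro x _ hx
    simp only [if_neg hx, zero_div]

theorem isPartialFraction_const (a : ℂ) : IsPartialFraction ζ ∅ ρ fun _ => a :=
  ⟨a, fun z _ => by simp⟩

theorem cross_partial_fractions {z : ℂ} (h1 : ∀ x ∈ D, z ≠ ζ x) (h2 : ∀ y ∈ D', z ≠ ζ y)
    (h : ∀ x ∈ D, ∀ y ∈ D', ζ x ≠ ζ y) :
    (∑ x ∈ D, ρ x / (z - ζ x)) * ∑ y ∈ D', σ y / (z - ζ y) =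
      ∑ x ∈ D, ρ x / (z - ζ x) * ∑ y ∈ D', σ y / (ζ x - ζ y) +
      ∑ y ∈ D', σ y / (z - ζ y) * ∑ x ∈ D, ρ x / (ζ y - ζ x) := by
  simp only [Finset.mul_sum, Finset.sum_mul]
  rw [Finset.sum_comm (s := D) (t := D') (f := fun x y => ρ x / (z - ζ x) * (σ y / (ζ x - ζ y))),
    ← Finset.sum_add_distrib]
  refine Finset.sum_congr rfl fun y hy => ?_
  rw [← Finset.sum_add_distrib]
  refine Finset.sum_congr rfl fun x hx => ?_
  have e1 := sub_ne_zero.2 (h1 x hx)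
  have e2 := sub_ne_zero.2 (h2 y hy)
  have e3 := sub_ne_zero.2 (h x hx y hy)
  have e4 := sub_ne_zero.2 (h x hx y hy).symm
  rw [← neg_sub (ζ x) (ζ y)]
  field_simp
  ring

/-- No pole of one factor meets a pole of the other, so all poles stay simple and each residue is
multiplied by the value of the other factor. Within one factor the points `ζ x` may coincide, as
happens for incompatible poles. -/
theorem IsPartialFraction.mul [DecidableEq ι] (hf : IsPartialFraction ζ D ρ f)
    (hg : IsPartialFraction ζ D' σ g) (h : ∀ x ∈ D, ∀ y ∈ D', ζ x ≠ ζ y) :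
    IsPartialFraction ζ (D ∪ D') (fun x => if x ∈ D then ρ x * g (ζ x) else f (ζ x) * σ x)
      (fun z => f z * g z) := by
  obtain ⟨a, ha⟩ := hf
  obtain ⟨b, hb⟩ := hg
  refine ⟨a * b, fun z hz => ?_⟩
  have hz1 : ∀ x ∈ D, z ≠ ζ x := fun x hx => hz x (Finset.mem_union_left _ hx)
  have hz2 : ∀ x ∈ D', z ≠ ζ x := fun x hx => hz x (Finset.mem_union_right _ hx)
  have hd : Disjoint D D' := Finset.disjoint_left.2 fun x hx hx' => h x hx x hx' rfl
  have s1 : ∑ x ∈ D, (if x ∈ D then ρ x * g (ζ x) else f (ζ x) * σ x) / (z - ζ x) =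
      ∑ x ∈ D, ρ x / (z - ζ x) * (b + ∑ y ∈ D', σ y / (ζ x - ζ y)) := by
    refine Finset.sum_congr rfl fun x hx => ?_
    rw [if_pos hx, hb _ fun y hy => h x hx y hy]
    ring
  have s2 : ∑ x ∈ D', (if x ∈ D then ρ x * g (ζ x) else f (ζ x) * σ x) / (z - ζ x) =
      ∑ x ∈ D', σ x / (z - ζ x) * (a + ∑ y ∈ D, ρ y / (ζ x - ζ y)) := by
    refine Finset.sum_congr rfl fun x hx => ?_
    rw [if_neg (Finset.disjoint_right.1 hd hx), ha _ fun y hy => (h y hy x hx).symm]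
    ring
  beta_reduce
  rw [Finset.sum_union hd, s1, s2, ha z hz1, hb z hz2]
  simp only [mul_add, Finset.sum_add_distrib, add_mul, ← Finset.sum_mul]
  rw [cross_partial_fractions hz1 hz2 h]
  ring

/-- $(\alpha+\beta z)/(z-\zeta)=\beta+(\alpha+\beta\zeta)/(z-\zeta)$: a vertex raises the growth at
infinity by one degree. -/
theorem IsPartialFraction.affine_mul (hf : IsPartialFraction ζ D ρ f) (α β : ℂ) :
    IsAffinePartialFraction ζ D (fun x => (α + β * ζ x) * ρ x) (fun z => (α + β * z) * f z) := by
  obtain ⟨a, ha⟩ := hf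
  refine ⟨α * a + β * ∑ x ∈ D, ρ x, β * a, fun z hz => ?_⟩
  beta_reduce
  rw [ha z hz]
  have : (α + β * z) * ∑ x ∈ D, ρ x / (z - ζ x) =
      β * ∑ x ∈ D, ρ x + ∑ x ∈ D, (α + β * ζ x) * ρ x / (z - ζ x) := by
    rw [Finset.mul_sum, Finset.mul_sum, ← Finset.sum_add_distrib]
    refine Finset.sum_congr rfl fun x hx => ?_
    have := sub_ne_zero.2 (hz x hx)
    field_simp
    ring
  rw [mul_add, this]
  ring

theorem IsAffinePartialFraction.sum {κ : Type*} {t : Finset κ} {ρ : κ → ι → ℂ} {f : κ → ℂ → ℂ}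
    (h : ∀ k ∈ t, IsAffinePartialFraction ζ D (ρ k) (f k)) :
    IsAffinePartialFraction ζ D (fun x => ∑ k ∈ t, ρ k x) (fun z => ∑ k ∈ t, f k z) := by
  classical
  choose! a b hab using h
  refine ⟨∑ k ∈ t, a k, ∑ k ∈ t, b k, fun z hz => ?_⟩
  beta_reduce
  rw [Finset.sum_congr rfl fun k hk => hab k hk z hz]
  simp only [Finset.sum_add_distrib, Finset.sum_mul, Finset.sum_div]
  rw [Finset.sum_comm]

theorem IsAffinePartialFraction.zero : IsAffinePartialFraction ζ D (fun _ => 0) (fun _ => 0) :=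
  ⟨0, 0, fun z _ => by simp⟩

/-- A propagator lowers the growth by one degree again and adds one simple pole, at a point where
`f` is regular. -/
theorem IsAffinePartialFraction.div [DecidableEq ι] (hf : IsAffinePartialFraction ζ D ρ f) {w : ι}
    (hw : ∀ x ∈ D, ζ x ≠ ζ w) :
    IsPartialFraction ζ (insert w D) (fun x => if x = w then f (ζ w) else ρ x / (ζ x - ζ w))
      (fun z => f z / (z - ζ w)) := by
  obtain ⟨a, b, hab⟩ := hf
  refine ⟨b, fun z hz => ?_⟩
  have hzw := sub_ne_zero.2 (hz w (Finset.mem_insert_self _ _))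
  have hz1 : ∀ x ∈ D, z ≠ ζ x := fun x hx => hz x (Finset.mem_insert_of_mem hx)
  have hwD : w ∉ D := fun h => hw w h rfl
  have s1 : ∑ x ∈ D, (if x = w then f (ζ w) else ρ x / (ζ x - ζ w)) / (z - ζ x) =
      ∑ x ∈ D, ρ x / (z - ζ x) * ∑ y ∈ ({w} : Finset ι), 1 / (ζ x - ζ y) := by
    refine Finset.sum_congr rfl fun x hx => ?_
    rw [if_neg (fun h : x = w => hwD (h ▸ hx)), Finset.sum_singleton]
    ring
  beta_reduce
  rw [Finset.sum_insert hwD, if_pos rfl, s1, hab z hz1, hab _ fun x hx => (hw x hx).symm]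
  have := cross_partial_fractions (ρ := ρ) (σ := fun _ => 1) hz1 (D' := {w})
    (fun y hy => by rw [Finset.mem_singleton.1 hy]; exact sub_ne_zero.1 hzw)
    (fun x hx y hy => by rw [Finset.mem_singleton.1 hy]; exact hw x hx)
  rw [Finset.sum_singleton, Finset.sum_singleton] at this
  rw [add_div, div_eq_mul_one_div (∑ x ∈ D, ρ x / (z - ζ x)), this]
  field_simp
  ring

end PartialFraction

/-! ### Replacing the legs of a planar pole by one leg -/

/-- The legs of the right amplitude as sets of particles. -/
def pinch (I : ℕ × ℕ) (t : ℕ) : Finset ℕ :=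
  if t < I.1 then {t} else if t = I.1 then Icc I.1 I.2 else {t + (I.2 - I.1)}

/-- The kinematics in which the particles of `I` are replaced by a single one. -/
abbrev pinched (s : ℕ → ℕ → ℂ) (I : ℕ × ℕ) : ℕ → ℕ → ℂ := mergeLegs s (pinch I)

theorem pinch_disjoint {I : ℕ × ℕ} {a b : ℕ} (h : a ≠ b) : Disjoint (pinch I a) (pinch I b) := by
  rw [Finset.disjoint_left]
  intro x hx hx'
  unfold pinch at hx hx'
  split_ifs at hx hx' <;> simp at hx hx' <;> omega

/-- In the ordered double sum, merging the legs of $I$ only discards the pairs inside $I$, whose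
total is $2s_I=0$: the merged leg is massless. -/
theorem inv_pinched {n : ℕ} {s : ℕ → ℕ → ℂ} (hs : IsMandelstam n s) {I : ℕ × ℕ}
    (h0 : planarInv s I = 0) {S : Finset ℕ} (hS : S.biUnion (pinch I) ⊆ Icc 1 n) :
    inv (pinched s I) S = inv s (S.biUnion (pinch I)) := by
  have hmem : ∀ a ∈ S, pinch I a ⊆ Icc 1 n := fun a ha =>
    (Finset.subset_biUnion_of_mem _ ha).trans hS
  have hdiag : ∀ a ∈ S, ∑ x ∈ pinch I a, ∑ y ∈ pinch I a, s x y = 0 := by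
    intro a ha
    rw [← hs.two_mul_inv (hmem a ha)]
    unfold pinch
    split_ifs
    · rw [inv_singleton, mul_zero]
    · exact mul_eq_zero_of_right 2 h0
    · rw [inv_singleton, mul_zero]
  have h1 := two_mul_inv (s := pinched s I) (S := S) (by
      intro a ha b hb
      by_cases hab : a = b
      · rw [hab]
      · simp only [pinched, mergeLegs]
        rw [if_neg hab, if_neg (Ne.symm hab), Finset.sum_comm]
        exact Finset.sum_congr rfl fun x hx => Finset.sum_congr rfl fun y hy =>
          hs.symm y (hmem a ha hy) x (hmem b hb hx)) (fun a _ => by simp [pinched, mergeLegs])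
  have h2 := hs.two_mul_inv hS
  rw [Finset.sum_biUnion fun a _ b _ h => pinch_disjoint h] at h2
  rw [← mul_right_inj' (two_ne_zero' ℂ), h1, h2]
  refine Finset.sum_congr rfl fun a ha => ?_
  rw [Finset.sum_congr rfl fun x _ =>
    Finset.sum_biUnion fun a _ b _ h => pinch_disjoint h, Finset.sum_comm]
  refine Finset.sum_congr rfl fun b hb => ?_
  by_cases hab : a = b
  · subst hab
    rw [hdiag a ha]
    simp [pinched, mergeLegs]
  · simp [pinched, mergeLegs, hab]

theorem pinch_biUnion_before {I : ℕ × ℕ} {S : Finset ℕ} (h : ∀ a ∈ S, a < I.1) :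
    S.biUnion (pinch I) = S := by
  ext x
  simp only [Finset.mem_biUnion]
  constructor
  · rintro ⟨a, ha, hx⟩
    rw [pinch, if_pos (h a ha), Finset.mem_singleton] at hx
    exact hx ▸ ha
  · intro hx
    exact ⟨x, hx, by rw [pinch, if_pos (h x hx)]; simp⟩

theorem pinch_biUnion_after {I : ℕ × ℕ} {S : Finset ℕ} (h : ∀ a ∈ S, I.1 < a) :
    S.biUnion (pinch I) = S.map (addRightEmbedding (I.2 - I.1)) := by
  ext x
  simp only [Finset.mem_biUnion, Finset.mem_map, addRightEmbedding_apply]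
  refine exists_congr fun a => and_congr_right fun ha => ?_
  have := h a ha
  rw [pinch, if_neg (by omega), if_neg (by omega), Finset.mem_singleton, eq_comm]

theorem pinch_biUnion_Ico {I : ℕ × ℕ} (hI : I.1 ≤ I.2) {i k : ℕ} (h1 : i ≤ I.1) (h2 : I.1 < k) :
    (Ico i k).biUnion (pinch I) = Ico i (k + (I.2 - I.1)) := by
  ext x
  simp only [Finset.mem_biUnion, Finset.mem_Ico]
  constructor
  · rintro ⟨a, ha, hx⟩
    unfold pinch at hx
    split_ifs at hx <;> simp at hx <;> omega
  · intro hx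
    rcases lt_or_ge x I.1 with h | h
    · exact ⟨x, by omega, by simp [pinch, h]⟩
    rcases le_or_gt x I.2 with h' | h'
    · exact ⟨I.1, by omega, by simp [pinch, h, h']⟩
    · refine ⟨x - (I.2 - I.1), by omega, ?_⟩
      rw [pinch, if_neg (by omega), if_neg (by omega), Finset.mem_singleton]
      omega

theorem dressed_pinched_before {n : ℕ} {s : ℕ → ℕ → ℂ} (hs : IsMandelstam n s) {I : ℕ × ℕ}
    {k i : ℕ} (hi : 1 ≤ i) (hn : i + k ≤ n + 1) (h : i + k ≤ I.1) :
    dressed (pinched s I) ∅ k i = dressed s ∅ k i := by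
  refine (dressed_shift (d := 0) fun a ha b hb => ?_).symm
  rw [Finset.mem_Ico] at ha hb
  by_cases hab : a = b
  · subst hab
    simpa [pinched, mergeLegs] using hs.diag a (by simp; omega)
  · simp [pinched, mergeLegs, hab, pinch, show a < I.1 by omega, show b < I.1 by omega]

theorem dressed_pinched_after {n : ℕ} {s : ℕ → ℕ → ℂ} (hs : IsMandelstam n s) {I : ℕ × ℕ}
    {k i : ℕ} (hi : I.1 < i) (hn : i + k + (I.2 - I.1) ≤ n + 1) :
    dressed (pinched s I) ∅ k i = dressed s ∅ k (i + (I.2 - I.1)) := by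
  refine (dressed_shift fun a ha b hb => ?_).symm
  rw [Finset.mem_Ico] at ha hb
  by_cases hab : a = b
  · subst hab
    simpa [pinched, mergeLegs] using hs.diag (a + (I.2 - I.1)) (by simp; omega)
  · simp [pinched, mergeLegs, hab, pinch, show ¬ a < I.1 by omega, show ¬ b < I.1 by omega,
      show a ≠ I.1 by omega, show b ≠ I.1 by omega]

/-! ### Compositions with one block containing a given pole -/

/-- Whether the positions `p, …, p + w` lie in one block. -/
def fits (w : ℕ) : ℕ → List ℕ → Bool
  | _, [] => false
  | p, k :: l => if p < k then decide (p + w < k) else fits w (p - k) l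

/-- Shorten the block of the position `p` by `w`. -/
def contract (w : ℕ) : ℕ → List ℕ → List ℕ
  | _, [] => []
  | p, k :: l => if p < k then (k - w) :: l else k :: contract w (p - k) l

theorem length_contract (w p : ℕ) (l : List ℕ) : (contract w p l).length = l.length := by
  induction l generalizing p with
  | nil => rfl
  | cons k l ih =>
    simp only [contract]
    split_ifs <;> simp [ih]

/-- Shortening the block that contains the chosen positions is a bijection onto all compositions of
`m - w`. First blocks of size between `p + 1` and `p + w` would cut the positions and contribute
nothing. -/
theorem csum_contract {w p m : ℕ} (h : p + w < m) (g : List ℕ → ℂ) :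
    csum m (fun l => if fits w p l then g (contract w p l) else 0) = csum (m - w) g := by
  induction m using Nat.strong_induction_on generalizing p g with
  | _ m ih =>
    rw [csum_cons (by omega), csum_cons (by omega)]
    have h1 : Icc 1 m = Icc 1 p ∪ (Icc (p + 1) (p + w) ∪ Icc (p + w + 1) m) := by
      ext x; simp; omega
    have h2 : Icc 1 (m - w) = Icc 1 p ∪ Icc (p + 1) (m - w) := by
      ext x; simp; omega
    rw [h1, h2, Finset.sum_union (Finset.disjoint_left.2 fun x hx hx' => by
        simp at hx hx'; omega), Finset.sum_union (Finset.disjoint_left.2 fun x hx hx' => by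
        simp at hx hx'; omega), Finset.sum_union (Finset.disjoint_left.2 fun x hx hx' => by
        simp at hx hx'; omega)]
    have hmid : ∑ k ∈ Icc (p + 1) (p + w), csum (m - k) (fun l =>
        if fits w p (k :: l) then g (contract w p (k :: l)) else 0) = 0 := by
      refine Finset.sum_eq_zero fun k hk => csum_eq_zero fun l _ _ => ?_
      rw [Finset.mem_Icc] at hk
      rw [if_neg]
      simp only [fits, if_pos (show p < k by omega), decide_eq_true_eq]
      omega
    rw [hmid, zero_add]
    congr 1
    · refine Finset.sum_congr rfl fun k hk => ?_
      rw [Finset.mem_Icc] at hk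
      simp only [fits, contract, if_neg (show ¬ p < k by omega)]
      rw [ih (m - k) (by omega) (p := p - k) (by omega) (fun l => g (k :: l))]
      congr 1
      omega
    · refine Finset.sum_nbij' (fun k => k - w) (fun k => k + w) ?_ ?_ ?_ ?_ ?_
      · intro k hk; simp at hk ⊢; omega
      · intro k hk; simp at hk ⊢; omega
      · intro k hk; simp at hk ⊢; omega
      · intro k hk; simp at hk ⊢
      · intro k hk
        rw [Finset.mem_Icc] at hk
        simp only [fits, contract, if_pos (show p < k by omega), show p + w < k by omega,
          decide_true, if_true]
        congr 1
        omega

theorem alternating_pinch_after {I : ℕ × ℕ} (b : Bool) {i : ℕ} (l : List ℕ) (h : I.1 < i) :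
    (alternating b i l).biUnion (pinch I) = alternating b (i + (I.2 - I.1)) l := by
  rw [pinch_biUnion_after, alternating_map]
  intro a ha
  have := alternating_subset _ _ _ ha
  simp at this; omega

/-- Contraction keeps the position of every block, so with `inv_pinched` the vertex has the same
value before and after pinching. -/
theorem alternating_contract {I : ℕ × ℕ} (hI : I.1 ≤ I.2) (b : Bool) {i : ℕ} {l : List ℕ}
    (h : i ≤ I.1) (hf : fits (I.2 - I.1) (I.1 - i) l) :
    (alternating b i (contract (I.2 - I.1) (I.1 - i) l)).biUnion (pinch I) =
      alternating b i l := by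
  induction l generalizing b i with
  | nil => simp [fits] at hf
  | cons k l ih =>
    simp only [fits] at hf
    simp only [contract]
    split_ifs at hf ⊢ with hk
    · have hk' : I.1 - i + (I.2 - I.1) < k := by simpa using hf
      have e1 : (Ico i (i + (k - (I.2 - I.1)))).biUnion (pinch I) = Ico i (i + k) := by
        rw [pinch_biUnion_Ico hI h (by omega)]
        congr 1; omega
      have e2 : i + (k - (I.2 - I.1)) + (I.2 - I.1) = i + k := by omega
      cases b <;> simp only [alternating, Finset.union_biUnion, e1]
      · rw [alternating_pinch_after _ _ (by omega), e2]
      · rw [alternating_pinch_after _ _ (by omega), e2]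
    · have e1 : (Ico i (i + k)).biUnion (pinch I) = Ico i (i + k) := by
        apply pinch_biUnion_before
        intro a ha
        simp at ha; omega
      have e2 : I.1 - i - k = I.1 - (i + k) := by omega
      rw [e2] at hf
      cases b <;> simp only [alternating, Finset.union_biUnion, e1, e2]
      · exact ih true (by omega) hf
      · rw [ih false (by omega) hf]

/-! ### Factorization of the deformed currents -/

theorem inv_deform (s r : ℕ → ℕ → ℂ) (z : ℂ) (S : Finset ℕ) :
    inv (deform s r z) S = inv s S + z * inv r S := by
  simp only [inv, deform, Finset.sum_add_distrib, Finset.mul_sum]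

theorem IsMandelstam.deform {n : ℕ} {s r : ℕ → ℕ → ℂ} (hs : IsMandelstam n s)
    (hr : IsMandelstam n r) (z : ℂ) : IsMandelstam n (deform s r z) where
  symm a ha b hb := by simp only [NLSM.deform, hs.symm a ha b hb, hr.symm a ha b hb]
  diag a ha := by simp [NLSM.deform, hs.diag a ha, hr.diag a ha]
  conservation a ha := by
    simp only [NLSM.deform, Finset.sum_add_distrib, ← Finset.mul_sum, hs.conservation a ha,
      hr.conservation a ha]
    simp

/-- The hypotheses on the deformation that the factorization needs. -/
structure IsGenericPencil (n : ℕ) (s r : ℕ → ℕ → ℂ) : Prop where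
  even : Even n
  mandelstam : IsMandelstam n s
  direction : IsMandelstam n r
  degree_one : ∀ I ∈ planarPoles n, planarInv r I ≠ 0
  zStar_ne : ∀ I ∈ planarPoles n, ∀ J ∈ planarPoles n, I ≠ J → Compatible I J →
    zStar s r I ≠ zStar s r J

theorem planarInv_deform {s r : ℕ → ℕ → ℂ} {I : ℕ × ℕ} (h : planarInv r I ≠ 0) (z : ℂ) :
    planarInv (deform s r z) I = planarInv r I * (z - zStar s r I) := by
  rw [planarInv, inv_deform, zStar]
  change planarInv s I + z * planarInv r I = _
  field_simp
  ring

/-- The planar poles of the interval `i, …, i + m - 1`. -/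
def poles (n i m : ℕ) : Finset (ℕ × ℕ) := (planarPoles n).filter fun I => i ≤ I.1 ∧ I.2 < i + m

theorem mem_planarPoles {n : ℕ} {I : ℕ × ℕ} : I ∈ planarPoles n ↔
    1 ≤ I.1 ∧ I.2 ≤ n - 1 ∧ I.1 < I.2 ∧ Even (I.2 - I.1) ∧ I.2 - I.1 + 4 ≤ n := by
  simp only [planarPoles, Finset.mem_filter, Finset.mem_product, Finset.mem_Icc]
  constructor
  · rintro ⟨⟨⟨h1, h2⟩, h3, h4⟩, h5, h6, h7⟩
    exact ⟨h1, h4, h5, h6, h7⟩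
  · rintro ⟨h1, h2, h3, h4, h5⟩
    exact ⟨⟨⟨h1, by omega⟩, by omega, h2⟩, h3, h4, h5⟩

theorem mem_poles {n i m : ℕ} {I : ℕ × ℕ} :
    I ∈ poles n i m ↔ I ∈ planarPoles n ∧ i ≤ I.1 ∧ I.2 < i + m := Finset.mem_filter

theorem poles_one (n i : ℕ) : poles n i 1 = ∅ := by
  refine Finset.eq_empty_of_forall_notMem fun I hI => ?_
  rw [mem_poles, mem_planarPoles] at hI
  omega

/-- The kinematics of the right amplitude at the pole `I`. -/
def pinchedAt (s r : ℕ → ℕ → ℂ) (I : ℕ × ℕ) : ℕ → ℕ → ℂ :=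
  pinched (deform s r (zStar s r I)) I

/-- The residue at the pole `I` of the current of the particles in `I` with its propagator. -/
def poleWeight (s r : ℕ → ℕ → ℂ) (I : ℕ × ℕ) : ℂ :=
  amputatedCurrent (deform s r (zStar s r I)) ∅ (I.2 - I.1 + 1) I.1 / planarInv r I

variable {n : ℕ} {s r : ℕ → ℕ → ℂ}

/-- The poles and residues of the current of the interval `i, …, i + m - 1` with its propagator. -/
def DressedFactorizes (n : ℕ) (s r : ℕ → ℕ → ℂ) (m i : ℕ) : Prop :=
  IsPartialFraction (zStar s r) (poles n i m)
    (fun I => poleWeight s r I * dressed (pinchedAt s r I) ∅ (m - (I.2 - I.1)) i)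
    (fun z => dressed (deform s r z) ∅ m i)

/-- Poles in different blocks are disjoint, hence compatible and at different points. The block
containing $I$ factorizes; blocks before it are unchanged by pinching, and blocks after it are only
relabelled. -/
theorem prodBlocks_factorizes (h : IsGenericPencil n s r) {i : ℕ} {l : List ℕ} (hi : 1 ≤ i)
    (hn : i + l.sum ≤ n)
    (hl : ∀ k ∈ l, ∀ j, i ≤ j → j + k ≤ i + l.sum → DressedFactorizes n s r k j) :
    IsPartialFraction (zStar s r)
      ((poles n i l.sum).filter fun I => fits (I.2 - I.1) (I.1 - i) l)
      (fun I => poleWeight s r I *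
        prodBlocks (dressed (pinchedAt s r I) ∅) i (contract (I.2 - I.1) (I.1 - i) l))
      (fun z => prodBlocks (dressed (deform s r z) ∅) i l) := by
  induction l generalizing i with
  | nil => simpa [fits, prodBlocks] using isPartialFraction_const 1
  | cons k l ih =>
    rw [List.sum_cons] at hn hl
    have h1 := hl k (by simp) i le_rfl (by omega)
    have h2 := ih (i := i + k) (by omega) (by omega)
      fun k' hk' j hj hj' => hl k' (by simp [hk']) j (by omega) (by omega)
    have hD : (poles n i (k :: l).sum).filter (fun I => fits (I.2 - I.1) (I.1 - i) (k :: l)) =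
        poles n i k ∪
          (poles n (i + k) l.sum).filter fun I => fits (I.2 - I.1) (I.1 - (i + k)) l := by
      ext I
      rw [Finset.mem_union, Finset.mem_filter, Finset.mem_filter, mem_poles, mem_poles, mem_poles,
        List.sum_cons]
      by_cases hI : I ∈ planarPoles n
      · have hlt := (mem_planarPoles.1 hI).2.2.1
        by_cases hi1 : i ≤ I.1
        · simp only [fits, hI, hi1, true_and]
          by_cases hk : I.1 - i < k
          · rw [if_pos hk, decide_eq_true_eq]
            omega
          · rw [if_neg hk, show I.1 - i - k = I.1 - (i + k) by omega]
            by_cases hf : fits (I.2 - I.1) (I.1 - (i + k)) l = true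
            · simp only [hf, and_true]; omega
            · simp only [hf]; simp; omega
        · omega
      · simp [hI]
    have hdisj : ∀ I ∈ poles n i k, ∀ J ∈ (poles n (i + k) l.sum).filter
        fun I => fits (I.2 - I.1) (I.1 - (i + k)) l, zStar s r I ≠ zStar s r J := by
      intro I hI J hJ
      rw [mem_poles] at hI
      rw [Finset.mem_filter, mem_poles] at hJ
      have hI' := (mem_planarPoles.1 hI.1).2.2.1
      refine h.zStar_ne I hI.1 J hJ.1.1 ?_ (Or.inr (Or.inr ?_))
      · rintro rfl; omega
      · refine Finset.disjoint_left.2 fun x hx hx' => ?_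
        simp at hx hx'; omega
    rw [hD]
    refine (h1.mul h2 hdisj).congr fun I hI => ?_
    have hM := h.mandelstam.deform h.direction (zStar s r I)
    split_ifs with hIk
    · rw [mem_poles] at hIk
      have hlt := mem_planarPoles.1 hIk.1
      simp only [contract, if_pos (show I.1 - i < k by omega), prodBlocks]
      rw [mul_assoc]
      congr 2
      rw [show i + k = i + (k - (I.2 - I.1)) + (I.2 - I.1) by omega]
      refine prodBlocks_congr fun k' hk' j hj hj' => ?_
      exact (dressed_pinched_after hM (by omega) (by omega)).symm
    · have hI := (Finset.mem_union.1 hI).resolve_left hIk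
      rw [Finset.mem_filter, mem_poles] at hI
      simp only [contract, if_neg (show ¬ I.1 - i < k by omega), prodBlocks]
      rw [show I.1 - i - k = I.1 - (i + k) by omega, pinchedAt,
        dressed_pinched_before hM hi (by omega) (by omega)]
      ring

theorem fits_lt {w p : ℕ} {l : List ℕ} (h : fits w p l) : ∃ k ∈ l, w < k := by
  induction l generalizing p with
  | nil => simp [fits] at h
  | cons k l ih =>
    simp only [fits] at h
    split_ifs at h with hp
    · have : p + w < k := by simpa using h
      exact ⟨k, by simp, by omega⟩
    · obtain ⟨k', hk', h'⟩ := ih h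
      exact ⟨k', by simp [hk'], h'⟩

/-- The pole of the whole interval is absent because its propagator is amputated. At $z_I^*$ only
compositions with a block containing $I$ have a residue, and contracting them reproduces the
recursion for the pinched current. -/
theorem current_factorizes (h : IsGenericPencil n s r) {m i : ℕ} (hi : 1 ≤ i) (hn : i + m ≤ n)
    (hl : ∀ k < m, 1 ≤ k → ∀ j, i ≤ j → j + k ≤ i + m → DressedFactorizes n s r k j) :
    IsAffinePartialFraction (zStar s r) ((poles n i m).erase (i, i + m - 1))
      (fun I => poleWeight s r I * amputatedCurrent (pinchedAt s r I) ∅ (m - (I.2 - I.1)) i)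
      (fun z => amputatedCurrent (deform s r z) ∅ m i) := by
  by_cases hm1 : m = 1
  · subst hm1
    refine ⟨1, 0, fun z _ => ?_⟩
    simp [poles_one, amputatedCurrent_one]
  set D := (poles n i m).erase (i, i + m - 1) with hD
  have hterm : ∀ c ∈ (univ : Finset (Composition m)),
      IsAffinePartialFraction (zStar s r) D
        (fun I => if fits (I.2 - I.1) (I.1 - i) c.blocks then
          (fun l => poleWeight s r I * (if 2 ≤ l.length ∧ Odd l.length then
            -inv (pinchedAt s r I) (evens i l) * prodBlocks (dressed (pinchedAt s r I) ∅) i l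
            else 0)) (contract (I.2 - I.1) (I.1 - i) c.blocks) else 0)
        (fun z => if 2 ≤ c.blocks.length ∧ Odd c.blocks.length then
          -inv (deform s r z) (evens i c.blocks) *
            prodBlocks (dressed (deform s r z) ∅) i c.blocks else 0) := by
    intro c _
    simp only [length_contract]
    by_cases hc : 2 ≤ c.blocks.length ∧ Odd c.blocks.length
    · simp only [if_pos hc]
      have hlt : ∀ k ∈ c.blocks, k < m := fun k hk =>
        c.blocks_sum ▸ lt_sum_of_mem (fun x hx => c.blocks_pos hx) hc.1 hk
      have hP := prodBlocks_factorizes h hi (l := c.blocks) (by rw [c.blocks_sum]; exact hn)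
        fun k hk j hj hj' => hl k (hlt k hk) (c.blocks_pos hk) j hj (by rwa [c.blocks_sum] at hj')
      rw [c.blocks_sum] at hP
      have hsub : (poles n i m).filter (fun I => fits (I.2 - I.1) (I.1 - i) c.blocks) ⊆ D := by
        intro I hI
        rw [Finset.mem_filter] at hI
        refine Finset.mem_erase.2 ⟨?_, hI.1⟩
        rintro rfl
        obtain ⟨k, hk, h'⟩ := fits_lt hI.2
        have := hlt k hk
        simp only at h'
        omega
      have hA := (hP.extend hsub).affine_mul (-inv s (evens i c.blocks))
        (-inv r (evens i c.blocks))
      have hfun : (fun z => -inv (deform s r z) (evens i c.blocks) *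
            prodBlocks (dressed (deform s r z) ∅) i c.blocks) =
          fun z => (-inv s (evens i c.blocks) + -inv r (evens i c.blocks) * z) *
            prodBlocks (dressed (deform s r z) ∅) i c.blocks := by
        funext z
        rw [inv_deform]; ring
      rw [hfun]
      refine hA.congr fun I hI => ?_
      have hIp := (Finset.mem_erase.1 hI).2
      have hI' := mem_poles.1 hIp
      have hI2 := mem_planarPoles.1 hI'.1
      simp only [Finset.mem_filter, hIp, true_and]
      split_ifs with hf
      · have hM := h.mandelstam.deform h.direction (zStar s r I)
        have hu := alternating_contract hI2.2.2.1.le true hI'.2.1 hf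
        rw [pinchedAt, inv_pinched hM, evens, hu, inv_deform]
        · ring
        · rw [planarInv_deform (h.degree_one I hI'.1), sub_self, mul_zero]
        · rw [evens, hu]
          refine (alternating_subset _ _ _).trans fun x hx => ?_
          rw [c.blocks_sum] at hx
          simp at hx ⊢; omega
      · rw [mul_zero]
    · simp only [if_neg hc, mul_zero, ite_self]
      exact IsAffinePartialFraction.zero
  have hfun : (fun z => amputatedCurrent (deform s r z) ∅ m i) = fun z => ∑ c : Composition m,
      if 2 ≤ c.blocks.length ∧ Odd c.blocks.length then
          -inv (deform s r z) (evens i c.blocks) *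
            prodBlocks (dressed (deform s r z) ∅) i c.blocks else 0 :=
    funext fun z => current_eq_csum (deform s r z) hm1 i
  rw [hfun]
  refine (IsAffinePartialFraction.sum hterm).congr fun I hI => ?_
  have hI' := mem_poles.1 (Finset.mem_erase.1 hI).2
  have hI2 := mem_planarPoles.1 hI'.1
  have hne : m - (I.2 - I.1) ≠ 1 := by
    intro hw
    apply (Finset.mem_erase.1 hI).1
    ext <;> simp <;> omega
  rw [current_eq_csum _ hne, ← csum_mul_left, ← csum_contract (p := I.1 - i) (w := I.2 - I.1)]
  · rfl
  · omega

/-- The new pole is that of the whole interval, with the amputated current as residue, up to the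
slope. At an inner pole the outer propagator is evaluated at $z_I^*$, which is finite because nested
poles are compatible. -/
theorem dressed_factorizes (h : IsGenericPencil n s r) {m i : ℕ} (hm : 1 ≤ m) (hi : 1 ≤ i)
    (hn : i + m ≤ n) (hmn : m + 2 ≤ n) : DressedFactorizes n s r m i := by
  induction m using Nat.strong_induction_on generalizing i with
  | _ m ih =>
    have hJ := current_factorizes h (m := m) hi hn fun k hk hk1 j hj hj' =>
      ih k hk hk1 (by omega) (by omega) (by omega)
    unfold DressedFactorizes
    rcases Nat.even_or_odd m with he | ho
    · refine ⟨0, fun z _ => ?_⟩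
      beta_reduce
      rw [dressed_even _ he, zero_add]
      refine (Finset.sum_eq_zero fun I hI => ?_).symm
      have := (mem_planarPoles.1 (mem_poles.1 hI).1).2.2.2.1
      rw [dressed_even _ (he.tsub this), mul_zero, zero_div]
    by_cases hm1 : m = 1
    · subst hm1
      simp only [poles_one, dressed_one]
      exact isPartialFraction_const 1
    -- Parity improves `m + 2 ≤ n` to `m + 3 ≤ n`, so the whole interval is a planar pole.
    obtain ⟨b, hb⟩ := id ho
    obtain ⟨b', hb'⟩ := id h.even
    set W : ℕ × ℕ := (i, i + m - 1) with hW
    have hWI : Icc W.1 W.2 = Ico i (i + m) := by ext x; simp [hW]; omega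
    have hWp : W ∈ planarPoles n := by
      rw [mem_planarPoles]
      refine ⟨hi, ?_, ?_, ⟨b, ?_⟩, ?_⟩ <;> simp only [hW] <;> omega
    have hWm : W ∈ poles n i m := mem_poles.2 ⟨hWp, by simp only [hW]; omega⟩
    have hr := h.degree_one W hWp
    have hfun : (fun z => dressed (deform s r z) ∅ m i) = fun z =>
        1 / planarInv r W * (amputatedCurrent (deform s r z) ∅ m i / (z - zStar s r W)) := by
      funext z
      have : propagator (deform s r z) (Ico i (i + m)) = 1 / planarInv (deform s r z) W := by
        rw [propagator, if_neg (by simpa using hm1), ← hWI]; rfl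
      rw [dressed, this, planarInv_deform hr, one_div, one_div, mul_inv]
      ring
    have hcompat : ∀ I ∈ (poles n i m).erase W, zStar s r I ≠ zStar s r W := by
      intro I hI
      obtain ⟨hne, hI'⟩ := Finset.mem_erase.1 hI
      have hI2 := mem_poles.1 hI'
      refine h.zStar_ne I hI2.1 W hWp hne (Or.inl ?_)
      rw [hWI]
      intro x hx
      simp at hx ⊢; omega
    have hdiv := hJ.div hcompat
    rw [Finset.insert_erase hWm] at hdiv
    obtain ⟨a, ha⟩ := hdiv
    rw [hfun]
    refine ⟨1 / planarInv r W * a, fun z hz => ?_⟩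
    beta_reduce
    have haz := ha z hz
    beta_reduce at haz
    rw [haz, mul_add, Finset.mul_sum]
    congr 1
    refine Finset.sum_congr rfl fun I hI => ?_
    have hI2 := mem_poles.1 hI
    have hI3 := mem_planarPoles.1 hI2.1
    split_ifs with hIW
    · have : m - (I.2 - I.1) = 1 := by rw [hIW]; simp only [hW]; omega
      rw [this, dressed_one, mul_one, poleWeight, hIW]
      rw [show W.2 - W.1 + 1 = m by simp only [hW]; omega, show W.1 = i from rfl]
      ring
    · have hne : m - (I.2 - I.1) ≠ 1 := by
        intro hw
        apply hIW
        ext <;> simp [hW] <;> omega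
      have hM := h.mandelstam.deform h.direction (zStar s r I)
      have hU : (Ico i (i + (m - (I.2 - I.1)))).biUnion (pinch I) = Ico i (i + m) := by
        rw [pinch_biUnion_Ico hI3.2.2.1.le hI2.2.1 (by omega)]
        congr 1; omega
      have hp : propagator (pinchedAt s r I) (Ico i (i + (m - (I.2 - I.1)))) =
          1 / (planarInv r W * (zStar s r I - zStar s r W)) := by
        rw [propagator, if_neg (by simpa using hne), pinchedAt, inv_pinched hM, hU, ← hWI,
          ← planarInv_deform hr, planarInv]
        · rw [planarInv_deform (h.degree_one I hI2.1), sub_self, mul_zero]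
        · rw [hU]
          intro x hx
          simp at hx ⊢; omega
      rw [dressed, hp, one_div, one_div, mul_inv]
      ring

/-- The interval `1, …, n - 1` is not a planar pole, so all of `planarPoles n` remains. Up to the
slope, `poleWeight` is the left amplitude, its amputated leg being the internal particle on shell.
-/
theorem amplitude_factorizes (h : IsGenericPencil n s r) (hn : 4 ≤ n) :
    IsAffinePartialFraction (zStar s r) (planarPoles n)
      (fun I => leftAmplitude n (deform s r (zStar s r I)) I / planarInv r I *
        rightAmplitude n (deform s r (zStar s r I)) I)
      (fun z => amplitude n (deform s r z)) := by
  have hJ := current_factorizes h (m := n - 1) (i := 1) le_rfl (by omega)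
    fun k hk hk1 j hj hj' => dressed_factorizes h hk1 hj (by omega) (by omega)
  have hD : (poles n 1 (n - 1)).erase (1, 1 + (n - 1) - 1) = planarPoles n := by
    ext I
    rw [Finset.mem_erase, mem_poles]
    refine ⟨fun h => h.2.1, fun hI => ?_⟩
    have hI' := mem_planarPoles.1 hI
    refine ⟨?_, hI, hI'.1, by omega⟩
    rintro rfl
    simp only at hI'
    omega
  rw [hD] at hJ
  refine hJ.congr fun I hI => ?_
  have hI' := mem_planarPoles.1 hI
  have hM := h.mandelstam.deform h.direction (zStar s r I)
  congr 1
  · rw [poleWeight, leftAmplitude, amplitude]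
    congr 1
    rw [show I.2 - I.1 + 2 - 1 = I.2 - I.1 + 1 by omega]
    have h1 : 1 + (I.1 - 1) = I.1 := by omega
    refine (congrArg (amputatedCurrent _ ∅ _) h1.symm).trans ?_
    refine current_shift fun a ha b hb => ?_
    rw [Finset.mem_Ico] at ha hb
    by_cases hab : a = b
    · subst hab
      simpa [mergeLegs] using hM.diag (a + (I.1 - 1)) (by simp; omega)
    · simp [mergeLegs, hab, show a ≤ I.2 - I.1 + 1 by omega, show b ≤ I.2 - I.1 + 1 by omega,
        show I.1 + a - 1 = a + (I.1 - 1) by omega, show I.1 + b - 1 = b + (I.1 - 1) by omega]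
  · rw [rightAmplitude, amplitude, show n - 1 - (I.2 - I.1) = n - (I.2 - I.1) - 1 by omega]
    rfl

/-! ### Consequences of the partial fraction expansion -/

section Residues

variable {ι : Type*} {ζ : ι → ℂ} {D : Finset ι} {ρ : ι → ℂ} {f : ℂ → ℂ}

/-- The residue theorem for $f(z)/(z(1-z^2))$, checked termwise: the affine part at 0 is the mean of
its values at $\pm1$, and each pole term differs from that mean by its residue contribution. -/
theorem IsAffinePartialFraction.value_zero (hf : IsAffinePartialFraction ζ D ρ f)
    (h0 : ∀ x ∈ D, 0 ≠ ζ x) (h1 : ∀ x ∈ D, 1 ≠ ζ x) (h2 : ∀ x ∈ D, -1 ≠ ζ x) :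
    f 0 = 1 / 2 * f 1 + 1 / 2 * f (-1) - ∑ x ∈ D, ρ x / (ζ x * (1 - ζ x ^ 2)) := by
  obtain ⟨a, b, hab⟩ := hf
  rw [hab 0 h0, hab 1 h1, hab (-1) h2]
  have : ∑ x ∈ D, ρ x / (0 - ζ x) = 1 / 2 * ∑ x ∈ D, ρ x / (1 - ζ x) +
      1 / 2 * ∑ x ∈ D, ρ x / (-1 - ζ x) - ∑ x ∈ D, ρ x / (ζ x * (1 - ζ x ^ 2)) := by
    rw [Finset.mul_sum, Finset.mul_sum, ← Finset.sum_add_distrib, ← Finset.sum_sub_distrib]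
    refine Finset.sum_congr rfl fun x hx => ?_
    have e0 := (h0 x hx).symm
    have e1 := sub_ne_zero.2 (h1 x hx)
    have e2 := sub_ne_zero.2 (h2 x hx)
    have e3 : 1 + ζ x ≠ 0 := by
      intro h; apply e2; linear_combination -h
    rw [show -1 - ζ x = -(1 + ζ x) by ring, show 1 - ζ x ^ 2 = (1 - ζ x) * (1 + ζ x) by ring]
    field_simp
    ring
  rw [this]
  ring

theorem tendsto_inv_sub_cobounded (w : ℂ) :
    Tendsto (fun z : ℂ => (z - w)⁻¹) (Bornology.cobounded ℂ) (𝓝 0) :=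
  
  tendsto_inv₀_cobounded.comp (tendsto_sub_const_cobounded w)

theorem IsAffinePartialFraction.tendsto (hf : IsAffinePartialFraction ζ D ρ f) :
    Tendsto (fun z => f z / (1 - z ^ 2)) (Bornology.cobounded ℂ) (𝓝 0) := by
  obtain ⟨a, b, hab⟩ := hf
  have hu := tendsto_inv_sub_cobounded 1
  have hv := tendsto_inv_sub_cobounded (-1)
  have hsum : Tendsto (fun z => ∑ x ∈ D, ρ x * (z - ζ x)⁻¹) (Bornology.cobounded ℂ) (𝓝 0) := by
    have := tendsto_finsetSum D fun x _ => (tendsto_inv_sub_cobounded (ζ x)).const_mul (ρ x)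
    simpa using this
  -- With $u=1/(z-1)$ and $v=1/(z+1)$ one has $1/(1-z^2)=-uv$ and $z/(1-z^2)=-(u+v)/2$.
  have hlim := (((hu.mul hv).const_mul (-a)).add ((hu.add hv).const_mul (-b / 2))).sub
    (hsum.mul (hu.mul hv))
  simp only [mul_zero, add_zero, sub_zero] at hlim
  refine hlim.congr' ?_
  have hfin : ∀ᶠ z in Bornology.cobounded ℂ, z ∉ (D.image ζ ∪ {1, -1} : Finset ℂ) :=
    (Finset.finite_toSet _).isBounded
  filter_upwards [hfin] with z hz
  simp only [Finset.mem_union, Finset.mem_image, Finset.mem_insert, Finset.mem_singleton,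
    not_or, not_exists, not_and] at hz
  rw [hab z fun x hx h => hz.1 x hx h.symm]
  have e1 := sub_ne_zero.2 hz.2.1
  have e2 : z + 1 ≠ 0 := fun h => hz.2.2 (eq_neg_of_add_eq_zero_left h)
  simp only [div_eq_mul_inv (ρ _)]
  rw [sub_neg_eq_add, show 1 - z ^ 2 = -((z - 1) * (z + 1)) by ring]
  field_simp
  ring

theorem IsAffinePartialFraction.circleIntegral (hf : IsAffinePartialFraction ζ D ρ f)
    (h0 : ∀ x ∈ D, 0 ≠ ζ x) :
    ∀ᶠ ε : ℝ in 𝓝[>] 0, f 0 =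
      (2 * Real.pi * Complex.I)⁻¹ * ∮ z in C(0, ε), f z / (z * (1 - z ^ 2)) := by
  obtain ⟨a, b, hab⟩ := hf
  -- An open neighbourhood of 0 on which $f/(1-z^2)$ is holomorphic; Cauchy's formula applies on
  -- closed discs inside it.
  set U : Set ℂ := {z | (∀ x ∈ D, z ≠ ζ x) ∧ 1 - z ^ 2 ≠ 0} with hU
  have hUo : IsOpen U := by
    have h1 : IsOpen {z : ℂ | ∀ x ∈ D, z ≠ ζ x} := by
      have : {z : ℂ | ∀ x ∈ D, z ≠ ζ x} = ⋂ x ∈ D, {z | z ≠ ζ x} := by ext; simp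
      rw [this]
      exact isOpen_biInter_finset fun x _ => isOpen_ne
    exact h1.inter (isOpen_ne_fun (by fun_prop) continuous_const)
  have hdiff : DifferentiableOn ℂ (fun z => f z / (1 - z ^ 2)) U := by
    have hg : DifferentiableOn ℂ
        (fun z => (a + b * z + ∑ x ∈ D, ρ x / (z - ζ x)) / (1 - z ^ 2)) U := by
      refine DifferentiableOn.div ?_ (by fun_prop) fun z hz => hz.2
      refine DifferentiableOn.add (by fun_prop) ?_
      refine DifferentiableOn.fun_sum fun x hx => ?_
      exact DifferentiableOn.div (by fun_prop) (by fun_prop) fun z hz => sub_ne_zero.2 (hz.1 x hx)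
    exact hg.congr fun z hz => by rw [hab z hz.1]
  obtain ⟨δ, hδ, hball⟩ := Metric.isOpen_iff.1 hUo 0 ⟨h0, by simp⟩
  filter_upwards [Ioo_mem_nhdsGT hδ] with ε hε
  have hsub : Metric.closedBall (0 : ℂ) ε ⊆ U :=
    (Metric.closedBall_subset_ball hε.2).trans hball
  have hC := (hdiff.mono ((Metric.closure_ball_subset_closedBall).trans hsub)).diffContOnCl
    |>.circleIntegral_sub_inv_smul (Metric.mem_ball_self hε.1)
  have hint : (∮ z in C(0, ε), f z / (z * (1 - z ^ 2))) =
      ∮ z in C(0, ε), (z - 0)⁻¹ • (f z / (1 - z ^ 2)) := by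
    congr 1
    funext z
    rw [sub_zero, smul_eq_mul, div_eq_mul_inv, div_eq_mul_inv, mul_inv]
    ring
  rw [hint, hC, smul_eq_mul, inv_mul_cancel_left₀ Complex.two_pi_I_ne_zero]
  simp

end Residues

/-! ### Six points -/

theorem csum_one (f : List ℕ → ℂ) : csum 1 f = f [1] := by
  rw [csum_cons one_pos]
  simp [csum_zero]

theorem csum_two (f : List ℕ → ℂ) : csum 2 f = f [1, 1] + f [2] := by
  rw [csum_cons (show 0 < 2 by norm_num)]
  simp [Finset.sum_Icc_succ_top, csum_zero, csum_one]

theorem csum_three (f : List ℕ → ℂ) :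
    csum 3 f = f [1, 1, 1] + f [1, 2] + f [2, 1] + f [3] := by
  rw [csum_cons (show 0 < 3 by norm_num)]
  simp [Finset.sum_Icc_succ_top, csum_zero, csum_one, csum_two]

theorem csum_four (f : List ℕ → ℂ) :
    csum 4 f = csum 3 (fun l => f (1 :: l)) + csum 2 (fun l => f (2 :: l)) + f [3, 1] + f [4] := by
  rw [csum_cons (show 0 < 4 by norm_num)]
  simp [Finset.sum_Icc_succ_top, csum_zero, csum_one]

theorem csum_five (f : List ℕ → ℂ) :
    csum 5 f = csum 4 (fun l => f (1 :: l)) + csum 3 (fun l => f (2 :: l)) +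
      csum 2 (fun l => f (3 :: l)) + f [4, 1] + f [5] := by
  rw [csum_cons (show 0 < 5 by norm_num)]
  simp [Finset.sum_Icc_succ_top, csum_zero, csum_one]

theorem inv_pair (s : ℕ → ℕ → ℂ) {a b : ℕ} (h : a < b) : inv s {a, b} = s a b := by
  simp [inv, Finset.sum_filter, h, h.ne, h.not_gt]

theorem inv_insert_min (s : ℕ → ℕ → ℂ) {a : ℕ} {S : Finset ℕ} (h : ∀ b ∈ S, a < b) :
    inv s (insert a S) = ∑ b ∈ S, s a b + inv s S := by
  have ha : a ∉ S := fun h' => lt_irrefl a (h a h')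
  unfold inv
  rw [Finset.sum_insert ha]
  congr 1
  · rw [Finset.filter_insert, if_neg (lt_irrefl a), Finset.filter_true_of_mem h]
  · refine Finset.sum_congr rfl fun b hb => ?_
    rw [Finset.filter_insert, if_neg (h b hb).not_gt]

theorem current_three (s : ℕ → ℕ → ℂ) (i : ℕ) :
    amputatedCurrent s ∅ 3 i = -s i (i + 2) := by
  have h : evens i [1, 1, 1] = {i, i + 2} := by
    ext x; simp [alternating]
  rw [current_eq_csum s (by norm_num), csum_three]
  simp [h, inv_pair, prodBlocks, dressed_one, show ¬ Odd 2 by decide, show Odd 3 by decide]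

theorem dressed_three (s : ℕ → ℕ → ℂ) (i : ℕ) :
    dressed s ∅ 3 i = -s i (i + 2) / (s i (i + 1) + s i (i + 2) + s (i + 1) (i + 2)) := by
  have h : Ico i (i + 3) = {i, i + 1, i + 2} := by
    ext x; simp; omega
  rw [dressed, current_three, propagator, if_neg (by simp), h,
    inv_insert_min s (by simp), inv_pair s (by omega), Finset.sum_pair (by omega)]
  ring

theorem planarInv_three (s : ℕ → ℕ → ℂ) (i : ℕ) :
    planarInv s (i, i + 2) = s i (i + 1) + s i (i + 2) + s (i + 1) (i + 2) := by
  have h : Icc i (i + 2) = {i, i + 1, i + 2} := by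
    ext x; simp; omega
  rw [planarInv, h, inv_insert_min s (by simp), inv_pair s (by omega), Finset.sum_pair (by omega)]

theorem amplitude_six {s : ℕ → ℕ → ℂ} (hs : IsMandelstam 6 s) (h1 : planarInv s (1, 3) ≠ 0)
    (h2 : planarInv s (2, 4) ≠ 0) (h3 : planarInv s (3, 5) ≠ 0) :
    amplitude 6 s =
      (s 1 2 + s 2 3 - planarInv s (1, 3)) * (s 4 5 + s 5 6) / planarInv s (1, 3) +
      (s 2 3 + s 3 4) * (s 5 6 + s 6 1 - planarInv s (2, 4)) / planarInv s (2, 4) +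
      (s 3 4 + s 4 5 - planarInv s (3, 5)) * (s 6 1 + s 1 2 - planarInv s (3, 5)) /
        planarInv s (3, 5) +
      s 3 4 + s 4 5 - planarInv s (3, 5) := by
  -- These are the only contributing compositions of 5: an odd number of blocks, at least three, all
  -- of odd size.
  have e1 : evens 1 [1, 1, 1, 1, 1] = {1, 3, 5} := by decide
  have e2 : evens 1 [1, 1, 3] = {1, 3, 4, 5} := by decide
  have e3 : evens 1 [1, 3, 1] = {1, 5} := by decide
  have e4 : evens 1 [3, 1, 1] = {1, 2, 3, 5} := by decide
  have hA : amplitude 6 s = -(s 1 3 + s 1 5 + s 3 5) +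
      -(s 1 3 + s 1 4 + s 1 5 + s 3 4 + s 3 5 + s 4 5) * dressed s ∅ 3 3 +
      -s 1 5 * dressed s ∅ 3 2 +
      -(s 1 2 + s 1 3 + s 1 5 + s 2 3 + s 2 5 + s 3 5) * dressed s ∅ 3 1 := by
    rw [amplitude, current_eq_csum s (by norm_num), csum_five, csum_four, csum_three, csum_three,
      csum_two, csum_two]
    simp [e1, e2, e3, e4, inv_singleton, inv_insert_min, prodBlocks, dressed_one,
      dressed_even s even_two, show ¬ Odd 2 by decide, show Odd 3 by decide, show ¬ Odd 4 by decide,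
      show Odd 5 by decide]
    ring
  have d1 := dressed_three s 1
  have d2 := dressed_three s 2
  have d3 := dressed_three s 3
  rw [← planarInv_three s 1] at d1
  rw [← planarInv_three s 2] at d2
  rw [← planarInv_three s 3] at d3
  have p1 := planarInv_three s 1
  have p2 := planarInv_three s 2
  have p3 := planarInv_three s 3
  norm_num at d1 d2 d3 p1 p2 p3
  have c1 := hs.conservation 1 (by simp)
  have c2 := hs.conservation 2 (by simp)
  have c3 := hs.conservation 3 (by simp)
  have c4 := hs.conservation 4 (by simp)
  have c5 := hs.conservation 5 (by simp)
  have c6 := hs.conservation 6 (by simp)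
  have hsum : ∀ f : ℕ → ℂ, ∑ b ∈ Icc 1 6, f b = f 1 + f 2 + f 3 + f 4 + f 5 + f 6 := fun f => by
    simp [Finset.sum_Icc_succ_top]
  rw [hsum] at c1 c2 c3 c4 c5 c6
  rw [hs.diag 1 (by simp)] at c1
  rw [hs.diag 2 (by simp), hs.symm 2 (by simp) 1 (by simp)] at c2
  rw [hs.diag 3 (by simp), hs.symm 3 (by simp) 1 (by simp), hs.symm 3 (by simp) 2 (by simp)] at c3
  rw [hs.diag 4 (by simp), hs.symm 4 (by simp) 1 (by simp), hs.symm 4 (by simp) 2 (by simp),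
    hs.symm 4 (by simp) 3 (by simp)] at c4
  rw [hs.diag 5 (by simp), hs.symm 5 (by simp) 1 (by simp), hs.symm 5 (by simp) 2 (by simp),
    hs.symm 5 (by simp) 3 (by simp), hs.symm 5 (by simp) 4 (by simp)] at c5
  rw [hs.diag 6 (by simp), hs.symm 6 (by simp) 1 (by simp), hs.symm 6 (by simp) 2 (by simp),
    hs.symm 6 (by simp) 3 (by simp), hs.symm 6 (by simp) 4 (by simp),
    hs.symm 6 (by simp) 5 (by simp)] at c6
  rw [hA, d1, d2, d3, hs.symm 6 (by simp) 1 (by simp)]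
  have q1 : s 1 3 = planarInv s (1, 3) - s 1 2 - s 2 3 := by linear_combination -p1
  have q2 : s 2 4 = planarInv s (2, 4) - s 2 3 - s 3 4 := by linear_combination -p2
  have q3 : s 3 5 = planarInv s (3, 5) - s 3 4 - s 4 5 := by linear_combination -p3
  -- This is $s_{234}=s_{561}$, obtained from the six conservation laws.
  have q4 : s 1 5 = planarInv s (2, 4) - s 5 6 - s 1 6 := by
    linear_combination (c1 + c5 + c6 - c2 - c3 - c4) / 2 - p2
  have q5 : s 2 5 = -(s 1 5 + s 3 5 + s 4 5 + s 5 6) := by linear_combination c5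
  have q6 : s 1 4 = -(s 1 2 + s 1 3 + s 1 5 + s 1 6) := by linear_combination c1
  rw [q5, q6, q1, q2, q3, q4]
  field_simp
  ring

theorem mixedCurrent_six {s : ℕ → ℕ → ℂ} (hs : IsMandelstam 6 s) (h1 : inv s {4, 5, 6} ≠ 0)
    (h2 : inv s {5, 6, 1} ≠ 0) :
    mixedCurrent 6 s =
      (s 4 5 + s 5 6) / inv s {4, 5, 6} + (s 5 6 + s 6 1) / inv s {5, 6, 1} - 1 := by
  have e1 : inv s {4, 5, 6} = s 4 5 + s 4 6 + s 5 6 := by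
    rw [inv_insert_min s (by simp), inv_pair s (by omega), Finset.sum_pair (by omega)]
  have e2 : inv s {5, 6, 1} = s 1 5 + s 6 1 + s 5 6 := by
    rw [show ({5, 6, 1} : Finset ℕ) = {1, 5, 6} by decide, inv_insert_min s (by simp),
      inv_pair s (by omega), Finset.sum_pair (by omega), hs.symm 1 (by simp) 6 (by simp)]
  rw [mixedCurrent_eq_csum (by norm_num), csum_four, csum_three, csum_two]
  simp [prodBlocks, dressed_one, dressed_even _ even_two, show ¬ Even 3 by decide,
    show Even 4 by decide, dressed_three, mixedLabel]
  rw [hs.symm 5 (by simp) 1 (by simp)]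
  rw [e1] at h1 ⊢
  rw [e2] at h2 ⊢
  have h2' : s 5 6 + s 1 5 + s 6 1 ≠ 0 := by
    intro h; apply h2; linear_combination h
  rw [show s 1 5 + s 6 1 + s 5 6 = s 5 6 + s 1 5 + s 6 1 by ring]
  field_simp
  ring

end NLSM

end

/-! ### Assembly of the recursion and the six-point formulas -/

theorem mainTheorem4 :
    -- the recursion
    (∀ (n : ℕ) (s r : ℕ → ℕ → ℂ), 6 ≤ n → Even n →
      NLSM.IsMandelstam n s → NLSM.IsSplitDeformation n s r →
      -- none of the points `0, 1, -1` is a pole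
      (∀ I ∈ NLSM.planarPoles n, NLSM.planarInv s I ≠ 0 ∧
        NLSM.planarInv (NLSM.deform s r 1) I ≠ 0 ∧
        NLSM.planarInv (NLSM.deform s r (-1)) I ≠ 0) →
      -- compatible poles are at different points
      (∀ I ∈ NLSM.planarPoles n, ∀ J ∈ NLSM.planarPoles n, I ≠ J → NLSM.Compatible I J →
        NLSM.planarInv (NLSM.deform s r (NLSM.zStar s r I)) J ≠ 0) →
      -- the deformed kinematics
      (∀ z : ℂ, NLSM.IsMandelstam n (NLSM.deform s r z)) ∧
      NLSM.IsSplit n 1 3 4 (NLSM.deform s r 1) ∧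
      NLSM.IsSplit n 1 2 4 (NLSM.deform s r (-1)) ∧
      (∀ I ∈ NLSM.planarPoles n, ∀ z : ℂ,
        NLSM.planarInv (NLSM.deform s r z) I = 0 ↔ z = NLSM.zStar s r I) ∧
      -- the contour integral, and the absence of a contribution from infinity
      (∀ᶠ ε : ℝ in 𝓝[>] 0, NLSM.amplitude n s =
        (2 * Real.pi * Complex.I)⁻¹ *
          ∮ z in C(0, ε), NLSM.amplitude n (NLSM.deform s r z) / (z * (1 - z ^ 2))) ∧
      Tendsto (fun z : ℂ => NLSM.amplitude n (NLSM.deform s r z) / (1 - z ^ 2))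
        (Bornology.cobounded ℂ) (𝓝 0) ∧
      -- the recursion formula
      NLSM.amplitude n s =
        1 / 2 * NLSM.amplitude n (NLSM.deform s r 1) +
        1 / 2 * NLSM.amplitude n (NLSM.deform s r (-1)) +
        ∑ I ∈ NLSM.planarPoles n,
          NLSM.leftAmplitude n (NLSM.deform s r (NLSM.zStar s r I)) I *
          (1 / ((1 - NLSM.zStar s r I ^ 2) * NLSM.planarInv s I)) *
          NLSM.rightAmplitude n (NLSM.deform s r (NLSM.zStar s r I)) I ∧
      -- the values at the two split points
      (NLSM.amplitude n (NLSM.deform s r 1) =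
          NLSM.mixedCurrent n (NLSM.deform s r 1) *
            (NLSM.deform s r 1 1 2 + NLSM.deform s r 1 2 3) ∧
        NLSM.deform s r 1 1 2 + NLSM.deform s r 1 2 3 = -(s 2 4 + r 2 4)) ∧
      (NLSM.amplitude n (NLSM.deform s r (-1)) =
          NLSM.mixedCurrent n (NLSM.deform s r (-1)) *
            (NLSM.deform s r (-1) 2 3 + NLSM.deform s r (-1) 3 4) ∧
        NLSM.deform s r (-1) 2 3 + NLSM.deform s r (-1) 3 4 = -(s 1 3 - r 1 3))) ∧
    -- the six-point amplitude, and the five-point current that enters its recursion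
    (∀ s : ℕ → ℕ → ℂ, NLSM.IsMandelstam 6 s →
      NLSM.planarInv s (1, 3) ≠ 0 → NLSM.planarInv s (2, 4) ≠ 0 → NLSM.planarInv s (3, 5) ≠ 0 →
      NLSM.amplitude 6 s =
        (s 1 2 + s 2 3 - NLSM.planarInv s (1, 3)) * (s 4 5 + s 5 6) / NLSM.planarInv s (1, 3) +
        (s 2 3 + s 3 4) * (s 5 6 + s 6 1 - NLSM.planarInv s (2, 4)) / NLSM.planarInv s (2, 4) +
        (s 3 4 + s 4 5 - NLSM.planarInv s (3, 5)) * (s 6 1 + s 1 2 - NLSM.planarInv s (3, 5)) /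
          NLSM.planarInv s (3, 5) +
        s 3 4 + s 4 5 - NLSM.planarInv s (3, 5)) ∧
    (∀ s : ℕ → ℕ → ℂ, NLSM.IsMandelstam 6 s →
      NLSM.inv s {4, 5, 6} ≠ 0 → NLSM.inv s {5, 6, 1} ≠ 0 →
      NLSM.mixedCurrent 6 s =
        (s 4 5 + s 5 6) / NLSM.inv s {4, 5, 6} + (s 5 6 + s 6 1) / NLSM.inv s {5, 6, 1} - 1) := by
  refine ⟨?_, fun s hs h1 h2 h3 => NLSM.amplitude_six hs h1 h2 h3,
    fun s hs h1 h2 => NLSM.mixedCurrent_six hs h1 h2⟩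
  intro n s r hn he hs hr hreg hcompat
  have hM : ∀ z : ℂ, NLSM.IsMandelstam n (NLSM.deform s r z) := fun z =>
    hs.deform hr.isMandelstam z
  have hzero : ∀ I ∈ NLSM.planarPoles n, ∀ z : ℂ,
      NLSM.planarInv (NLSM.deform s r z) I = 0 ↔ z = NLSM.zStar s r I := by
    intro I hI z
    rw [NLSM.planarInv_deform (hr.degree_one I hI), mul_eq_zero, or_iff_right (hr.degree_one I hI),
      sub_eq_zero]
  have hgen : NLSM.IsGenericPencil n s r :=
    ⟨he, hs, hr.isMandelstam, hr.degree_one, fun I hI J hJ hne hc h =>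
      hcompat I hI J hJ hne hc ((hzero J hJ _).2 h)⟩
  have hd0 : NLSM.deform s r 0 = s := by
    funext a b; simp [NLSM.deform]
  have hP := NLSM.amplitude_factorizes hgen (by omega)
  have n0 : ∀ I ∈ NLSM.planarPoles n, 0 ≠ NLSM.zStar s r I := fun I hI h =>
    (hreg I hI).1 (by rw [← (hzero I hI 0).2 h, hd0])
  have n1 : ∀ I ∈ NLSM.planarPoles n, 1 ≠ NLSM.zStar s r I := fun I hI h =>
    (hreg I hI).2.1 ((hzero I hI 1).2 h)
  have n2 : ∀ I ∈ NLSM.planarPoles n, -1 ≠ NLSM.zStar s r I := fun I hI h =>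
    (hreg I hI).2.2 ((hzero I hI (-1)).2 h)
  have z2 : ∀ b ∈ Icc 5 n, NLSM.deform s r 1 2 b = 0 := fun b hb => by
    rw [NLSM.deform, hr.two b hb]; ring
  have z3 : ∀ b ∈ Icc 5 n, NLSM.deform s r (-1) 3 b = 0 := fun b hb => by
    rw [NLSM.deform, hr.three b hb]; ring
  have hsplitsum : ∀ f : ℕ → ℂ, (∀ b ∈ Icc 5 n, f b = 0) →
      ∑ b ∈ Icc 1 n, f b = f 1 + f 2 + f 3 + f 4 := by
    intro f hf
    rw [← Finset.sum_subset (s₁ := Icc 1 4) (fun x hx => by simp at hx ⊢; omega)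
      fun x hx hx' => hf x (by simp at hx hx' ⊢; omega)]
    simp [Finset.sum_Icc_succ_top]
  have m1 : 1 ∈ Icc 1 n := by simp; omega
  have m2 : 2 ∈ Icc 1 n := by simp; omega
  have m3 : 3 ∈ Icc 1 n := by simp; omega
  -- At $z=1$ conservation for leg 2 involves only legs 1, 3 and 4.
  have c2 : NLSM.deform s r 1 1 2 + NLSM.deform s r 1 2 3 = -NLSM.deform s r 1 2 4 := by
    have := (hM 1).conservation 2 m2
    rw [hsplitsum _ z2, (hM 1).diag 2 m2, (hM 1).symm 2 m2 1 m1] at this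
    linear_combination this
  have c3 : NLSM.deform s r (-1) 2 3 + NLSM.deform s r (-1) 3 4 = -NLSM.deform s r (-1) 3 1 := by
    have := (hM (-1)).conservation 3 m3
    rw [hsplitsum _ z3, (hM (-1)).diag 3 m3, (hM (-1)).symm 3 m3 2 m2] at this
    linear_combination this
  refine ⟨hM, ?_, ?_, hzero, ?_, hP.tendsto, ?_, ⟨?_, ?_⟩, ⟨?_, ?_⟩⟩
  -- The arcs cut out by 1, 3, 4 are `{2}`, the empty arc and `5, …, n`, so only the pairs of leg 2
  -- with `5, …, n` matter.
  · intro a ha b hb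
    simp only [Finset.mem_Icc] at ha hb
    refine ⟨fun h => by omega, fun h => by omega, fun h => ?_⟩
    obtain rfl : b = 2 := by omega
    rw [(hM 1).symm a (by simpa using ha) 2 m2]
    exact z2 a (by simp; omega)
  · intro a ha b hb
    simp only [Finset.mem_Icc] at ha hb
    refine ⟨fun h => by omega, fun h => ?_, fun h => by omega⟩
    obtain rfl : a = 3 := by omega
    exact z3 b (by simp; omega)
  · have := hP.circleIntegral n0
    rwa [hd0] at this
  · have := hP.value_zero n0 n1 n2
    beta_reduce at this
    rw [hd0] at this
    rw [this, sub_eq_add_neg, ← Finset.sum_neg_distrib]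
    congr 1
    refine Finset.sum_congr rfl fun I hI => ?_
    -- The slope of $s_I(z)$ times $-z_I^*$ is $s_I$; this turns the residue denominators into the
    -- undeformed propagators and absorbs the sign.
    have hsI : NLSM.planarInv s I = -(NLSM.planarInv r I * NLSM.zStar s r I) := by
      have h := NLSM.planarInv_deform (hr.degree_one I hI) (s := s) 0
      rw [hd0] at h
      rw [h]; ring
    rw [hsI]
    simp only [div_eq_mul_inv, mul_inv, inv_neg]
    ring
  · rw [NLSM.amplitude_split_two hn he (hM 1) (fun I hI => (hreg I hI).2.1) z2, c2, mul_comm]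
  · rw [c2, NLSM.deform]; ring
  · rw [NLSM.amplitude_split_three hn he (hM (-1)) (fun I hI => (hreg I hI).2.2) z3, c3, mul_comm]
  · rw [c3, (hM (-1)).symm 3 m3 1 m1, NLSM.deform]; ring
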